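/- Let $d,n\ge 1$, $\gamma,T\in\mathbb R$, $\eta,\lambda\in\mathbb R^d$, $\varepsilon>0$. On $n$ qubits put $\sigma_{01}=|0\rangle\langle 1|$, $\sigma_{10}=|1\rangle\langle 0|$ and, for $1\le j\le n$, $$s_j^-=I^{\otimes(n-j)}\otimes\sigma_{01}\otimes\sigma_{10}^{\otimes(j-1)},\qquad s_j^+=I^{\otimes(n-j)}\otimes\sigma_{10}\otimes\sigma_{01}^{\otimes(j-1)}$$ (the rightmost factor is qubit $1$). On $dn$ qubits put $(s^\mu_j)_\alpha=I^{\otimes(\alpha-1)n}\otimes s^\mu_j\otimes I^{\otimes(d-\alpha)n}$ and $$\mathcal H=\gamma\sum_{\alpha=1}^d\sum_{j=1}^n\eta_\alpha\big(e^{i\lambda_\alpha}(s^-_j)_\alpha+e^{-i\lambda_\alpha}(s^+_j)_\alpha\big).$$ Let $U_j(\theta)=\big(\prod_{m<j}\mathrm{CNOT}^j_m\big)P_j(\theta)H_j$, where $\mathrm{CNOT}^j_m$ has control $j$ and target $m$, $P_j(\theta)$ is the phase gate $\mathrm{diag}(1,e^{i\theta})$ and $H_j$ the Hadamard gate on qubit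 $j$. Let $\mathrm{CRZ}_j(\theta)$ be the rotation $e^{-i\theta Z/2}$ of qubit $j$ controlled by all of the qubits $1,\dots,j-1$, and let $$W_j(\varphi,\theta)=U_j(-\theta)\,\mathrm{CRZ}_j(2\varphi)\,U_j(-\theta)^\dagger,\qquad V(\varphi,\theta)=W_1(\varphi,\theta)\cdots W_n(\varphi,\theta).$$ Circuits consist of arbitrary single-qubit unitaries and CNOT gates on the $dn$ qubits, without ancillas; non-local gates are CNOT gates. Write $x=\gamma^2T^2\sum_{\alpha}\eta_\alpha^2/\varepsilon$ and $r=\max\{1,\lceil (n-1)x/2\rceil\}$. There are circuits $S_{d,n}(\varphi,\lambda)$, $\varphi,\lambda\in\mathbb R^d$, such that the following holds. 1. $S_{d,n}(\varphi,\lambda)$ implements the one time step unitary $\bigotimes_{\alpha=1}^d V(\varphi_\alpha,\lambda_\alpha)$ exactly, with at most $d(9n^2-33n+34)$ CNOT gates. 2. Let $\mathcal C$ be the $r$-fold repetition of $S_{d,n}\big((\gamma\eta_\alpha T/r)_{\alpha},\lambda\big)$. Then $\mathcal C$ implements $\exp(-i\mathcal HT)$ up to an error of at most $\varepsilon$ in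 the operator norm, with at most $r\,d(9n^2-33n+34)$ CNOT gates. 3. The number of CNOT gates of $\mathcal C$ is $O\big(dn^3\gamma^2T^2\sum_\alpha\eta_\alpha^2/\varepsilon\big)$ for small $\varepsilon$: there is an absolute constant $C$ such that it is at most $C\,dn^3x$ whenever $nx\ge 1$. 4. The leading term of the number of CNOT gates of $\mathcal C$ is $9dn^3\gamma^2T^2\sum_\alpha\eta_\alpha^2/(2\varepsilon)$: the ratio of the two tends to $1$ as $n\to\infty$ and $nx\to\infty$, uniformly in all the parameters. -/

import Mathlib

open scoped Matrix Matrix.Norms.L2Operator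

noncomputable section

namespace HamSim

/-- Operators on a register of qubits labelled by `Q`, as matrices in the computational basis,
whose elements are the bit strings `Q → Fin 2`. -/
abbrev Op (Q : Type) : Type := Matrix (Q → Fin 2) (Q → Fin 2) ℂ

section Register

variable {Q : Type} [Fintype Q] [DecidableEq Q]

/-- The tensor product over all qubits `q` of the one-qubit operators `A q`. -/
def tensorQubits (A : Q → Matrix (Fin 2) (Fin 2) ℂ) : Op Q :=
  Matrix.of fun x y => ∏ q, A q (x q) (y q)

/-- The one-qubit operator `A` acting on qubit `q`, identity elsewhere. -/
def onQubit (q : Q) (A : Matrix (Fin 2) (Fin 2) ℂ) : Op Q :=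
  tensorQubits (Function.update (fun _ => 1) q A)

/-- CNOT with control `c` and target `t`: it maps the basis state `y` to `y` with the bit `y t`
replaced by `y t ⊕ y c` (addition in `Fin 2`). -/
def cnotOp (c t : Q) : Op Q :=
  Matrix.of fun x y => if x = Function.update y t (y t + y c) then 1 else 0

end Register

/-- Elementary gates: arbitrary one-qubit unitaries, and CNOT gates. -/
inductive Gate (Q : Type) : Type
  | single (q : Q) (U : Matrix.unitaryGroup (Fin 2) ℂ) : Gate Q
  | cnot (c t : Q) (h : c ≠ t) : Gate Q

/-- The unitary of a gate. -/
def Gate.toOp {Q : Type} [Fintype Q] [DecidableEq Q] : Gate Q → Op Q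
  | .single q U => onQubit q (U : Matrix (Fin 2) (Fin 2) ℂ)
  | .cnot c t _ => cnotOp c t

/-- The number of non-local (CNOT) gates that a gate counts for. -/
def Gate.cnots {Q : Type} : Gate Q → ℕ
  | .single _ _ => 0
  | .cnot _ _ _ => 1

/-- A quantum circuit on the qubits `Q` without ancillas; the head of the list is applied first. -/
abbrev Circuit (Q : Type) : Type := List (Gate Q)

/-- The unitary implemented by a circuit. -/
def Circuit.eval {Q : Type} [Fintype Q] [DecidableEq Q] : Circuit Q → Op Q
  | [] => 1
  | g :: gs => Circuit.eval gs * g.toOp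

/-- The number of CNOT gates of a circuit. -/
def Circuit.cnotCount {Q : Type} (C : Circuit Q) : ℕ := (C.map Gate.cnots).sum

/-- The circuit `C` applied `r` times in succession. -/
def Circuit.rep {Q : Type} (r : ℕ) (C : Circuit Q) : Circuit Q :=
  (List.replicate r C).flatten

/-- The ladder operator `|0⟩⟨1|`. -/
def sigma01 : Matrix (Fin 2) (Fin 2) ℂ := !![0, 1; 0, 0]

/-- The ladder operator `|1⟩⟨0|`. -/
def sigma10 : Matrix (Fin 2) (Fin 2) ℂ := !![0, 0; 1, 0]

/-- The projector `|1⟩⟨1|`. -/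
def sigma11 : Matrix (Fin 2) (Fin 2) ℂ := !![0, 0; 0, 1]

/-- The Hadamard gate. -/
def hadamard : Matrix (Fin 2) (Fin 2) ℂ := ((1 / Real.sqrt 2 : ℝ) : ℂ) • !![1, 1; 1, -1]

/-- The phase gate. -/
def phase (lam : ℝ) : Matrix (Fin 2) (Fin 2) ℂ := !![1, 0; 0, Complex.exp (Complex.I * lam)]

/-- The rotation `exp (-i θ Z / 2)`. -/
def rz (θ : ℝ) : Matrix (Fin 2) (Fin 2) ℂ :=
  !![Complex.exp (-(Complex.I * θ / 2)), 0; 0, Complex.exp (Complex.I * θ / 2)]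

section OneAxis

variable {n : ℕ}

/-- `I^{⊗(n-j)} ⊗ σ₀₁ ⊗ σ₁₀^{⊗(j-1)}`. The rightmost tensor factor is the first qubit, and the
`j`-th qubit has the index `j - 1` in `Fin n`. -/
def sMinus (j : Fin n) : Op (Fin n) :=
  tensorQubits fun k => if k < j then sigma10 else if k = j then sigma01 else 1

/-- `I^{⊗(n-j)} ⊗ σ₁₀ ⊗ σ₀₁^{⊗(j-1)}`. -/
def sPlus (j : Fin n) : Op (Fin n) :=
  tensorQubits fun k => if k < j then sigma01 else if k = j then sigma10 else 1

/-- `U_j(λ) = (∏_{m < j} CNOT^j_m) P_j(λ) H_j`, where `CNOT^j_m` has control `j` and target `m`. -/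
def bellU (j : Fin n) (lam : ℝ) : Op (Fin n) :=
  (((List.finRange n).filter (· < j)).map fun m => cnotOp j m).prod *
    onQubit j (phase lam) * onQubit j hadamard

/-- The RZ gate on qubit `j`, controlled by all qubits `m < j`:
`exp(-i θ Z_j / 2) ⊗ |1⟩⟨1|^{⊗(j-1)} + I ⊗ (I^{⊗(j-1)} - |1⟩⟨1|^{⊗(j-1)})`. -/
def mcRZ (j : Fin n) (θ : ℝ) : Op (Fin n) :=
  tensorQubits (fun k => if k < j then sigma11 else if k = j then rz θ else 1) +
    (1 - tensorQubits fun k => if k < j then sigma11 else 1)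

/-- `W_j(φ, λ) = U_j(-λ) CRZ_j(2 φ) U_j(-λ)†`. -/
def stepW (j : Fin n) (φ lam : ℝ) : Op (Fin n) :=
  bellU j (-lam) * mcRZ j (2 * φ) * (bellU j (-lam))ᴴ

/-- The one time step unitary `V(φ, λ) = W_1(φ, λ) W_2(φ, λ) ⋯ W_n(φ, λ)`. -/
def stepV (n : ℕ) (φ lam : ℝ) : Op (Fin n) :=
  ((List.finRange n).map fun j => stepW j φ lam).prod

end OneAxis

section Axes

variable {d n : ℕ}

/-- The tensor product `⨂_α A_α` of operators on the `d` groups of `n` qubits; qubit `j` of group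
`α` carries the label `(α, j)`. -/
def tensorAxes (A : Fin d → Op (Fin n)) : Op (Fin d × Fin n) :=
  Matrix.of fun x y => ∏ α, A α (fun j => x (α, j)) (fun j => y (α, j))

/-- `(A)_α = I^{⊗(α-1)n} ⊗ A ⊗ I^{⊗(d-α)n}`. -/
def onAxis (α : Fin d) (A : Op (Fin n)) : Op (Fin d × Fin n) :=
  tensorAxes (Function.update (fun _ => 1) α A)

/-- `γ ∑_α ∑_j η_α (e^{iλ_α} (s⁻_j)_α + e^{-iλ_α} (s⁺_j)_α)`. -/
def hamiltonian (n : ℕ) (γ : ℝ) (η lam : Fin d → ℝ) : Op (Fin d × Fin n) :=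
  (γ : ℂ) • ∑ α, ∑ j : Fin n, (η α : ℂ) •
    (Complex.exp (Complex.I * lam α) • onAxis α (sMinus j) +
      Complex.exp (-(Complex.I * lam α)) • onAxis α (sPlus j))

/-- The time evolution operator `exp(-i H T)`. -/
def evolution (n : ℕ) (γ : ℝ) (η lam : Fin d → ℝ) (T : ℝ) : Op (Fin d × Fin n) :=
  NormedSpace.exp ((-(Complex.I * T)) • hamiltonian n γ η lam)

/-- The number of Trotter steps: the least integer `r ≥ 1` with
`r ≥ γ² T² (n - 1) ∑ η_α² / (2 ε)`. -/
def numSteps (n : ℕ) (γ : ℝ) (η : Fin d → ℝ) (T ε : ℝ) : ℕ :=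
  max 1 ⌈γ ^ 2 * T ^ 2 * ((n : ℝ) - 1) * (∑ α, η α ^ 2) / (2 * ε)⌉₊

/-- The simulation circuit obtained from circuits `step φ λ` for one time step: with
`r = numSteps n γ η T ε` and `τ = T / r`, repeat the step with angles `φ_α = γ η_α τ` and phases
`λ_α` exactly `r` times. -/
def simCircuit (step : (Fin d → ℝ) → (Fin d → ℝ) → Circuit (Fin d × Fin n))
    (γ : ℝ) (η lam : Fin d → ℝ) (T ε : ℝ) : Circuit (Fin d × Fin n) :=
  Circuit.rep (numSteps n γ η T ε)
    (step (fun α => γ * η α * (T / (numSteps n γ η T ε : ℝ))) lam)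

end Axes

end HamSim

end

open scoped Matrix Matrix.Norms.L2Operator

set_option linter.unusedSectionVars false

noncomputable section

namespace HamSim

/-! ### Algebra of uniformly controlled gates and of weighted classical maps. -/

section Multiplexed

variable {Q : Type} [Fintype Q] [DecidableEq Q]

/-! Trotter error. Write `h_j = e^{iλ} s_j⁻ + e^{-iλ} s_j⁺` (`hop`). Conjugation by `U_j(-λ)` turns
`h_j` into `Z` on qubit `j` times the projector onto ones on the qubits below, so each `W_j(φ, λ)`
is exactly `exp(-iφ h_j)` (`hop_eq`, `stepW_eq_exp`). Distinct `h_j`, `h_k` with `j, k ≥ 2` have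
product zero (`hop_mul_hop`), so `V` only separates `h_1` from `B = h_2 + ⋯ + h_n`. The first-order
product formula has error at most half the norm of the commutator
(`norm_exp_add_sub_exp_mul_exp_le`), and each `[h_1, h_k]` has norm at most one
(`norm_commutator_le_one`). One step on one axis therefore costs `φ² (n - 1) / 2`
(`norm_exp_sub_stepV_le`). The axes commute and all factors are unitary, so the errors add over axes
and over the `r` steps, and `r` is chosen to make the total at most `ε`.

Gate count. The controlled rotation is a group commutator of quarter rotations with two
multi-controlled `X` gates (`commutator_eq`), each taking half of the controls and borrowing dirty
ancillas from the other half (`controlledRZ_spec`). Phases of the `X` gates cancel in the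
commutator, so cheap relative-phase versions suffice: `8k - 10` CNOTs for `k ≥ 3` controls
(`mcxCircuit_spec`). With `m` controls the two gates occur twice each, costing about `16m`, and the
basis change costs `2m`. Summing `18m` over `m < n` gives the leading term `9n²` per axis and step
(`stepCount_le`, `le_stepCount`), and `r ≈ nx/2` gives `9dn³x/2`. -/

theorem tensorQubits_mul (A B : Q → Matrix (Fin 2) (Fin 2) ℂ) :
    tensorQubits A * tensorQubits B = tensorQubits fun q => A q * B q := by
  ext x y
  simp only [tensorQubits, Matrix.mul_apply, Matrix.of_apply, ← Finset.prod_mul_distrib]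
  rw [Finset.prod_univ_sum]
  simp

theorem tensorQubits_conjTranspose (A : Q → Matrix (Fin 2) (Fin 2) ℂ) :
    (tensorQubits A)ᴴ = tensorQubits fun q => (A q)ᴴ := by
  ext x y
  simp [tensorQubits, Matrix.conjTranspose_apply]

theorem tensorQubits_eq_zero {A : Q → Matrix (Fin 2) (Fin 2) ℂ} (q : Q) (h : A q = 0) :
    tensorQubits A = 0 := by
  ext x y
  simp only [tensorQubits, Matrix.of_apply, Matrix.zero_apply]
  exact Finset.prod_eq_zero (Finset.mem_univ q) (by simp [h])

/-- The gate on qubit `t` that is uniformly controlled by all other qubits: it acts on qubit `t` as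
`F y`, where `y` holds the bits of the other qubits (and `0` at `t`). -/
def ucOp (t : Q) (F : (Q → Fin 2) → Matrix (Fin 2) (Fin 2) ℂ) : Op Q :=
  Matrix.of fun x y => if Function.update x t 0 = Function.update y t 0 then
    F (Function.update y t 0) (x t) (y t) else 0

theorem eq_of_update_eq {t : Q} {x y : Q → Fin 2}
    (h : Function.update x t 0 = Function.update y t 0) (ht : x t = y t) : x = y := by
  funext q
  by_cases hq : q = t
  · rw [hq, ht]
  · simpa [hq] using congrFun h q

theorem ucOp_mul (t : Q) (F G : (Q → Fin 2) → Matrix (Fin 2) (Fin 2) ℂ) :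
    ucOp t F * ucOp t G = ucOp t fun y => F y * G y := by
  ext x y
  simp only [ucOp, Matrix.mul_apply, Matrix.of_apply]
  symm
  by_cases h : Function.update x t 0 = Function.update y t 0
  · rw [if_pos h]
    -- Only the intermediate states that agree with `y` off `t` contribute, so the sum over all bit
    -- strings collapses to that of a `2 × 2` product.
    refine Finset.sum_of_injOn (fun b => Function.update y t b) ?_ ?_ ?_ ?_
    · intro b _ b' _ hb
      simpa using congrFun hb t
    · simp [Set.MapsTo]
    · intro z _ hz
      have : Function.update z t 0 ≠ Function.update y t 0 := by
        intro hzy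
        apply hz
        refine ⟨z t, by simp, eq_of_update_eq (t := t) ?_ (by simp)⟩
        simp [hzy]
      rw [if_neg this, mul_zero]
    · intro b _
      simp [h]
  · rw [if_neg h]
    symm
    refine Finset.sum_eq_zero fun z _ => ?_
    by_cases h1 : Function.update x t 0 = Function.update z t 0
    · rw [if_neg fun h2 => h (h1.trans h2), mul_zero]
    · rw [if_neg h1, zero_mul]

theorem ucOp_one (t : Q) : ucOp t (fun _ => 1) = 1 := by
  ext x y
  simp only [ucOp, Matrix.of_apply, Matrix.one_apply]
  by_cases h : x = y
  · simp [h]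
  · rw [if_neg h]
    by_cases h1 : Function.update x t 0 = Function.update y t 0
    · rw [if_pos h1, if_neg fun h2 => h (eq_of_update_eq h1 h2)]
    · rw [if_neg h1]

theorem ucOp_conjTranspose (t : Q) (F : (Q → Fin 2) → Matrix (Fin 2) (Fin 2) ℂ) :
    (ucOp t F)ᴴ = ucOp t fun y => (F y)ᴴ := by
  ext x y
  simp only [ucOp, Matrix.of_apply, Matrix.conjTranspose_apply]
  by_cases h : Function.update x t 0 = Function.update y t 0
  · rw [if_pos h, if_pos h.symm, h]
  · rw [if_neg h, if_neg (Ne.symm h), star_zero]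

theorem ucOp_congr {t : Q} {F G : (Q → Fin 2) → Matrix (Fin 2) (Fin 2) ℂ}
    (h : ∀ y, F y = G y) : ucOp t F = ucOp t G := by
  rw [funext h]

theorem onQubit_eq_ucOp (t : Q) (A : Matrix (Fin 2) (Fin 2) ℂ) :
    onQubit t A = ucOp t fun _ => A := by
  ext x y
  simp only [onQubit, tensorQubits, ucOp, Matrix.of_apply]
  rw [← Finset.mul_prod_erase _ _ (Finset.mem_univ t), Function.update_self]
  by_cases h : Function.update x t 0 = Function.update y t 0
  · rw [if_pos h, Finset.prod_eq_one, mul_one]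
    intro q hq
    have hq : q ≠ t := Finset.ne_of_mem_erase hq
    have := congrFun h q
    simp only [Function.update_of_ne hq] at this
    simp [hq, this]
  · rw [if_neg h]
    obtain ⟨q, hq⟩ := Function.ne_iff.mp h
    have hqt : q ≠ t := by rintro rfl; simp at hq
    rw [Finset.prod_eq_zero (i := q), mul_zero]
    · simp [hqt]
    · rw [Function.update_of_ne hqt, Matrix.one_apply_ne]
      simpa [hqt] using hq

/-- The Pauli matrix `X`. -/
def pauliX : Matrix (Fin 2) (Fin 2) ℂ := !![0, 1; 1, 0]

theorem pauliX_apply (a b : Fin 2) : pauliX a b = if a = b + 1 then 1 else 0 := by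
  fin_cases a <;> fin_cases b <;> simp [pauliX]

theorem pauliX_mul_self : pauliX * pauliX = 1 := by
  ext a b; fin_cases a <;> fin_cases b <;> simp [pauliX]

theorem pauliX_conjTranspose : pauliXᴴ = pauliX := by
  ext a b; fin_cases a <;> fin_cases b <;> simp [pauliX]

theorem cnotOp_eq_ucOp {c t : Q} (h : c ≠ t) :
    cnotOp c t = ucOp t fun y => if y c = 1 then pauliX else 1 := by
  ext x y
  have key : x = Function.update y t (y t + y c) ↔
      Function.update x t 0 = Function.update y t 0 ∧ x t = y t + y c := by
    constructor
    · rintro rfl; simp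
    · rintro ⟨h1, h2⟩
      exact eq_of_update_eq (t := t) (by simpa using h1) (by simpa using h2)
  simp only [cnotOp, ucOp, Matrix.of_apply, key, Function.update_of_ne h]
  by_cases h1 : Function.update x t 0 = Function.update y t 0
  · simp only [h1, true_and, if_true]
    obtain hc | hc : y c = 0 ∨ y c = 1 := by omega
    · simp [hc, Matrix.one_apply]
    · simp [hc, pauliX_apply]
  · simp [h1]

/-- A weighted classical map: it sends the basis state `y` to `p y` times the basis state `τ y`. -/
def monoOp (p : (Q → Fin 2) → ℂ) (τ : (Q → Fin 2) → Q → Fin 2) : Op Q :=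
  Matrix.of fun x y => if x = τ y then p y else 0

theorem monoOp_one : monoOp (fun _ => 1) id = (1 : Op Q) := by
  ext x y; simp [monoOp, Matrix.one_apply]

theorem monoOp_mul (p p' : (Q → Fin 2) → ℂ) (τ τ' : (Q → Fin 2) → Q → Fin 2) :
    monoOp p τ * monoOp p' τ' = monoOp (fun y => p (τ' y) * p' y) (τ ∘ τ') := by
  ext x y
  simp only [monoOp, Matrix.mul_apply, Matrix.of_apply]
  rw [Finset.sum_eq_single (τ' y)]
  · by_cases h : x = τ (τ' y) <;> simp [h]
  · intro z _ hz
    simp [hz]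
  · simp

/-- This is what makes dirty ancillas usable: a classical map that neither reads nor changes the bit
`t` can be pulled through a gate on `t`, at the price of permuting the control values. -/
theorem monoOp_mul_ucOp {t : Q} {p : (Q → Fin 2) → ℂ} {τ : (Q → Fin 2) → Q → Fin 2}
    (hτ : Function.Involutive τ) (hp : ∀ y b, p (Function.update y t b) = p y)
    (hu : ∀ y b, τ (Function.update y t b) = Function.update (τ y) t b)
    (F : (Q → Fin 2) → Matrix (Fin 2) (Fin 2) ℂ) :
    monoOp p τ * ucOp t F = (ucOp t fun y => F (τ y)) * monoOp p τ := by
  -- Writing the bit `y t` back into `y` changes nothing, so `hu` forces `τ` to keep the bit `t`.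
  have ht : ∀ y, τ y t = y t := fun y => by
    have := hu y (y t)
    rw [Function.update_eq_self] at this
    simpa using congrFun this t
  ext x y
  simp only [Matrix.mul_apply]
  rw [Finset.sum_eq_single (τ x), Finset.sum_eq_single (τ y)]
  · simp only [monoOp, ucOp, Matrix.of_apply, hτ x, if_true, ht, ← hu]
    have hiff : τ (Function.update x t 0) = Function.update y t 0 ↔
        Function.update x t 0 = τ (Function.update y t 0) :=
      ⟨fun h => by rw [← h, hτ], fun h => by rw [h, hτ]⟩
    by_cases h : τ (Function.update x t 0) = Function.update y t 0
    · rw [if_pos h, if_pos (hiff.mp h), hτ, mul_comm, ← hp (τ x) 0, ← hu, h, hp]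
    · rw [if_neg h, if_neg fun h' => h (hiff.mpr h')]; simp
  · intro z _ hz
    simp [monoOp, hz]
  · simp
  · intro z _ hz
    have : x ≠ τ z := fun h => hz (by rw [h, hτ])
    simp [monoOp, this]
  · simp

/-- Each block is diagonal or antidiagonal according to `f y`, hence has a single possibly nonzero
entry per column. Independence of `f` from the bit `t` makes the classical map well described on
full bit strings. -/
theorem ucOp_eq_monoOp {t : Q} {F : (Q → Fin 2) → Matrix (Fin 2) (Fin 2) ℂ}
    {f : (Q → Fin 2) → Fin 2} (hf : ∀ y b, f (Function.update y t b) = f y)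
    (h : ∀ y i k, i ≠ k + f y → F y i k = 0) :
    ucOp t F = monoOp (fun y => F (Function.update y t 0) (y t + f y) (y t))
      (fun y => Function.update y t (y t + f y)) := by
  ext x y
  simp only [ucOp, monoOp, Matrix.of_apply]
  by_cases h1 : Function.update x t 0 = Function.update y t 0
  · rw [if_pos h1]
    by_cases h2 : x t = y t + f y
    · rw [if_pos, h2]
      exact eq_of_update_eq (t := t) (by simpa using h1) (by simpa using h2)
    · rw [if_neg, h]
      · rwa [hf]
      · rintro rfl; simp at h2
  · rw [if_neg h1, if_neg]
    rintro rfl; simp at h1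

end Multiplexed

/-! ### Unitarity, inversion and composition of circuits, with their CNOT counts. -/

section Circuits

variable {Q : Type} [Fintype Q] [DecidableEq Q]

theorem phase_mem_unitary (θ : ℝ) : phase θ ∈ Matrix.unitaryGroup (Fin 2) ℂ := by
  rw [Matrix.mem_unitaryGroup_iff']
  ext a b
  fin_cases a <;> fin_cases b <;>
    simp [phase, Matrix.mul_apply, Matrix.star_apply, ← Complex.exp_conj, ← Complex.exp_add]

theorem rz_mem_unitary (θ : ℝ) : rz θ ∈ Matrix.unitaryGroup (Fin 2) ℂ := by
  rw [Matrix.mem_unitaryGroup_iff']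
  ext a b
  fin_cases a <;> fin_cases b <;>
    simp [rz, Matrix.mul_apply, Matrix.star_apply, ← Complex.exp_conj, ← Complex.exp_add, neg_div,
      Complex.conj_ofNat]

theorem invSqrtTwo_mul_self :
    ((1 / Real.sqrt 2 : ℝ) : ℂ) * ((1 / Real.sqrt 2 : ℝ) : ℂ) = 1 / 2 := by
  rw [← Complex.ofReal_mul, div_mul_div_comm, Real.mul_self_sqrt (by norm_num)]
  norm_num

theorem hadamard_conjTranspose : hadamardᴴ = hadamard := by
  ext a b
  fin_cases a <;> fin_cases b <;> simp [hadamard]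

theorem hadamard_conj (A : Matrix (Fin 2) (Fin 2) ℂ) :
    hadamard * A * hadamard = (1 / 2 : ℂ) • (!![1, 1; 1, -1] * A * !![1, 1; 1, -1]) := by
  rw [hadamard, Matrix.smul_mul, Matrix.smul_mul, Matrix.mul_smul, smul_smul, invSqrtTwo_mul_self]

theorem hadamard_mul_self : hadamard * hadamard = 1 := by
  rw [hadamard, Matrix.smul_mul, Matrix.mul_smul, smul_smul, invSqrtTwo_mul_self]
  ext a b
  fin_cases a <;> fin_cases b <;> norm_num [Matrix.mul_apply]

theorem hadamard_mem_unitary : hadamard ∈ Matrix.unitaryGroup (Fin 2) ℂ := by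
  rw [Matrix.mem_unitaryGroup_iff', Matrix.star_eq_conjTranspose, hadamard_conjTranspose,
    hadamard_mul_self]

theorem pauliX_mem_unitary : pauliX ∈ Matrix.unitaryGroup (Fin 2) ℂ := by
  rw [Matrix.mem_unitaryGroup_iff', Matrix.star_eq_conjTranspose, pauliX_conjTranspose,
    pauliX_mul_self]

/-- The inverse gate. -/
def Gate.inv {Q : Type} : Gate Q → Gate Q
  | .single q U => .single q (star U)
  | .cnot c t h => .cnot c t h

/-- The inverse circuit. -/
def Circuit.inv {Q : Type} (C : Circuit Q) : Circuit Q := (C.map Gate.inv).reverse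

theorem Gate.toOp_inv (g : Gate Q) : g.inv.toOp = g.toOpᴴ := by
  cases g with
  | single q U =>
    simp only [Gate.inv, Gate.toOp, onQubit_eq_ucOp, ucOp_conjTranspose]
    rfl
  | cnot c t h =>
    simp only [Gate.inv, Gate.toOp, cnotOp_eq_ucOp h, ucOp_conjTranspose]
    refine ucOp_congr fun y => ?_
    split_ifs <;> simp [pauliX_conjTranspose]

theorem Gate.toOp_mem_unitary (g : Gate Q) : g.toOpᴴ * g.toOp = 1 := by
  cases g with
  | single q U =>
    simp only [Gate.toOp, onQubit_eq_ucOp, ucOp_conjTranspose, ucOp_mul]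
    have := Matrix.mem_unitaryGroup_iff'.mp U.2
    rw [Matrix.star_eq_conjTranspose] at this
    rw [this, ucOp_one]
  | cnot c t h =>
    simp only [Gate.toOp, cnotOp_eq_ucOp h, ucOp_conjTranspose, ucOp_mul]
    rw [← ucOp_one t]
    refine ucOp_congr fun y => ?_
    split_ifs <;> simp [pauliX_conjTranspose, pauliX_mul_self]

@[simp] theorem Circuit.eval_nil : Circuit.eval ([] : Circuit Q) = 1 := rfl

@[simp] theorem Circuit.eval_cons (g : Gate Q) (C : Circuit Q) :
    Circuit.eval (g :: C) = Circuit.eval C * g.toOp := rfl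

@[simp] theorem Circuit.eval_append (C D : Circuit Q) :
    Circuit.eval (C ++ D) = Circuit.eval D * Circuit.eval C := by
  induction C with
  | nil => simp
  | cons g C ih => simp only [List.cons_append, Circuit.eval_cons, ih, mul_assoc]

theorem Circuit.eval_inv (C : Circuit Q) : Circuit.eval C.inv = (Circuit.eval C)ᴴ := by
  induction C with
  | nil => simp [Circuit.inv]
  | cons g C ih =>
    have : Circuit.inv (g :: C) = Circuit.inv C ++ [g.inv] := by simp [Circuit.inv]
    rw [this, Circuit.eval_append, ih]
    simp [Gate.toOp_inv]

theorem Circuit.eval_conjTranspose_mul (C : Circuit Q) :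
    (Circuit.eval C)ᴴ * Circuit.eval C = 1 := by
  induction C with
  | nil => simp
  | cons g C ih =>
    rw [Circuit.eval_cons, Matrix.conjTranspose_mul, mul_assoc, ← mul_assoc _ _ g.toOp, ih,
      one_mul, g.toOp_mem_unitary]

theorem Circuit.eval_mul_conjTranspose (C : Circuit Q) :
    Circuit.eval C * (Circuit.eval C)ᴴ = 1 :=
  mul_eq_one_comm.mp C.eval_conjTranspose_mul

theorem Circuit.eval_flatten (Cs : List (Circuit Q)) :
    Circuit.eval Cs.flatten = (Cs.reverse.map Circuit.eval).prod := by
  induction Cs with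
  | nil => simp
  | cons C Cs ih => simp [ih]

theorem Circuit.eval_rep (r : ℕ) (C : Circuit Q) :
    Circuit.eval (Circuit.rep r C) = Circuit.eval C ^ r := by
  rw [Circuit.rep, Circuit.eval_flatten]
  simp

end Circuits

@[simp] theorem Circuit.cnotCount_nil {Q : Type} : Circuit.cnotCount ([] : Circuit Q) = 0 := rfl

@[simp] theorem Circuit.cnotCount_append {Q : Type} (C D : Circuit Q) :
    Circuit.cnotCount (C ++ D) = Circuit.cnotCount C + Circuit.cnotCount D := by
  simp [Circuit.cnotCount]

theorem Circuit.cnotCount_inv {Q : Type} (C : Circuit Q) :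
    Circuit.cnotCount C.inv = Circuit.cnotCount C := by
  have : Gate.cnots ∘ Gate.inv = (Gate.cnots : Gate Q → ℕ) := by
    funext g; cases g <;> rfl
  simp [Circuit.cnotCount, Circuit.inv, this]

theorem Circuit.cnotCount_flatten {Q : Type} (Cs : List (Circuit Q)) :
    Circuit.cnotCount Cs.flatten = (Cs.map Circuit.cnotCount).sum := by
  induction Cs with
  | nil => simp
  | cons C Cs ih => simp [ih]

theorem Circuit.cnotCount_rep {Q : Type} (r : ℕ) (C : Circuit Q) :
    Circuit.cnotCount (Circuit.rep r C) = r * Circuit.cnotCount C := by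
  rw [Circuit.rep, Circuit.cnotCount_flatten]
  simp

/-- `X ^ b` for a bit `b`. -/
def bitX (b : Fin 2) : Matrix (Fin 2) (Fin 2) ℂ := if b = 1 then pauliX else 1

@[simp] theorem bitX_zero : bitX 0 = 1 := rfl

@[simp] theorem bitX_one : bitX 1 = pauliX := rfl

theorem bitX_mul (a b : Fin 2) : bitX a * bitX b = bitX (a + b) := by
  fin_cases a <;> fin_cases b <;> simp [bitX, pauliX_mul_self]

theorem bitX_conjTranspose (b : Fin 2) : (bitX b)ᴴ = bitX b := by
  fin_cases b <;> simp [bitX, pauliX_conjTranspose]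

section Elementary

variable {Q : Type} [Fintype Q] [DecidableEq Q]

/-- The circuit that consists of a single one-qubit gate. -/
def oneQubit {Q : Type} (q : Q) (A : Matrix (Fin 2) (Fin 2) ℂ)
    (hA : A ∈ Matrix.unitaryGroup (Fin 2) ℂ) : Circuit Q := [.single q ⟨A, hA⟩]

/-- The circuit that consists of a single CNOT gate. -/
def cx (c t : Q) : Circuit Q := if h : c ≠ t then [.cnot c t h] else []

theorem eval_oneQubit (q : Q) (A : Matrix (Fin 2) (Fin 2) ℂ)
    (hA : A ∈ Matrix.unitaryGroup (Fin 2) ℂ) :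
    (oneQubit q A hA).eval = ucOp q fun _ => A := by
  simp [oneQubit, Gate.toOp, onQubit_eq_ucOp]

theorem cnotOp_eq_ucOp_bitX {c t : Q} (h : c ≠ t) :
    cnotOp c t = ucOp t fun y => bitX (y c) :=
  cnotOp_eq_ucOp h

theorem eval_cx {c t : Q} (h : c ≠ t) : (cx c t).eval = ucOp t fun y => bitX (y c) := by
  simp [cx, h, Gate.toOp, cnotOp_eq_ucOp_bitX h]

@[simp] theorem cnotCount_oneQubit {Q : Type} (q : Q) (A : Matrix (Fin 2) (Fin 2) ℂ)
    (hA : A ∈ Matrix.unitaryGroup (Fin 2) ℂ) : (oneQubit q A hA).cnotCount = 0 := rfl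

theorem cnotCount_cx {c t : Q} (h : c ≠ t) : (cx c t).cnotCount = 1 := by
  simp [cx, h, Circuit.cnotCount, Gate.cnots]

end Elementary

/-! ### Relative-phase Toffoli ladder on dirty ancillas. -/

section Toggle

/-- The one-qubit factor, depending on a control bit `b`, of half a relative-phase Toffoli gate:
conjugation by it turns `X` into a diagonal matrix if `b = 0` and an antidiagonal one if `b = 1`. -/
def halfToffoli (b : Fin 2) : Matrix (Fin 2) (Fin 2) ℂ :=
  hadamard * phase (-(Real.pi / 4)) * bitX b * phase (Real.pi / 4)

theorem phase_conjTranspose (θ : ℝ) : (phase θ)ᴴ = phase (-θ) := by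
  ext a b
  fin_cases a <;> fin_cases b <;> simp [phase, ← Complex.exp_conj]

theorem phase_mul_phase_neg (θ : ℝ) : phase θ * phase (-θ) = 1 := by
  rw [← phase_conjTranspose, ← Matrix.star_eq_conjTranspose]
  exact Matrix.mem_unitaryGroup_iff.mp (phase_mem_unitary θ)

theorem bitX_mul_self (b : Fin 2) : bitX b * bitX b = 1 := by
  rw [bitX_mul]; fin_cases b <;> simp

theorem halfToffoli_mul_conjTranspose (b : Fin 2) : halfToffoli b * (halfToffoli b)ᴴ = 1 := by
  have h := phase_mul_phase_neg (-(Real.pi / 4))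
  rw [neg_neg] at h
  simp only [halfToffoli, Matrix.conjTranspose_mul, phase_conjTranspose, bitX_conjTranspose,
    hadamard_conjTranspose, neg_neg]
  calc _ = hadamard * (phase (-(Real.pi / 4)) * (bitX b * (phase (Real.pi / 4) *
        phase (-(Real.pi / 4))) * bitX b) * phase (Real.pi / 4)) * hadamard := by
        simp only [mul_assoc]
    _ = 1 := by
      rw [phase_mul_phase_neg, mul_one, bitX_mul_self, mul_one, h, mul_one, hadamard_mul_self]

theorem exp_pi_div_four_sq :
    Complex.exp (Complex.I * ((Real.pi / 4 : ℝ) : ℂ)) *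
      Complex.exp (Complex.I * ((Real.pi / 4 : ℝ) : ℂ)) = Complex.I := by
  rw [← Complex.exp_add]
  refine Eq.trans (congrArg Complex.exp ?_) Complex.exp_pi_div_two_mul_I
  push_cast
  ring

/-- The product is `-Y`; the two entries are `e^{±iπ/2}`, which is the reason for the angle `π/4`.
-/
theorem phase_bitX_alternating :
    phase (-(Real.pi / 4)) * pauliX * phase (Real.pi / 4) * pauliX * phase (-(Real.pi / 4)) *
      pauliX * phase (Real.pi / 4) = !![0, Complex.I; -Complex.I, 0] := by
  have h := exp_pi_div_four_sq
  have h' : Complex.exp (Complex.I * ((-(Real.pi / 4) : ℝ) : ℂ)) *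
      Complex.exp (Complex.I * ((-(Real.pi / 4) : ℝ) : ℂ)) = -Complex.I := by
    have := congrArg (starRingEnd ℂ) h
    rw [map_mul, ← Complex.exp_conj] at this
    simpa [Complex.conj_ofNat] using this
  ext a b
  fin_cases a <;> fin_cases b <;>
    simp only [phase, pauliX, Matrix.mul_apply, Fin.sum_univ_two] <;> simp
  · simpa using h
  · simpa using h'

/-- For `g = 0` the conjugate is the identity. For `g = 1` it is `H X H = Z` when `b = 0` and `H
(-Y) H = Y` when `b = 1`. So it acts as `X ^ (b * g)` up to entrywise phases: a Toffoli gate with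
relative phases. -/
theorem halfToffoli_conj_apply (b g i k : Fin 2) (h : i ≠ k + b * g) :
    (halfToffoli b * bitX g * (halfToffoli b)ᴴ) i k = 0 := by
  obtain rfl | rfl : g = 0 ∨ g = 1 := by omega
  · rw [bitX_zero, mul_one, halfToffoli_mul_conjTranspose, Matrix.one_apply_ne]
    simpa using h
  rw [bitX_one, halfToffoli]
  simp only [Matrix.conjTranspose_mul, phase_conjTranspose, bitX_conjTranspose,
    hadamard_conjTranspose, neg_neg]
  obtain rfl | rfl : b = 0 ∨ b = 1 := by omega
  · have h0 := phase_mul_phase_neg (-(Real.pi / 4))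
    rw [neg_neg] at h0
    rw [bitX_zero, mul_one, mul_assoc hadamard, h0, mul_one, one_mul,
      ← mul_assoc (phase _), h0, one_mul, hadamard_conj]
    fin_cases i <;> fin_cases k <;> simp [pauliX] at h ⊢
  · have : hadamard * phase (-(Real.pi / 4)) * bitX 1 * phase (Real.pi / 4) * pauliX *
        (phase (-(Real.pi / 4)) * (bitX 1 * (phase (Real.pi / 4) * hadamard))) =
        hadamard * !![0, Complex.I; -Complex.I, 0] * hadamard := by
      rw [← phase_bitX_alternating, bitX_one]
      simp only [mul_assoc]
    rw [this, hadamard_conj]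
    fin_cases i <;> fin_cases k <;> simp at h ⊢

variable {Q : Type} [Fintype Q] [DecidableEq Q]

/-- The circuit for `halfToffoli`, with control `c` and target `a`. -/
def halfToffoliCircuit (c a : Q) : Circuit Q :=
  oneQubit a (phase (Real.pi / 4)) (phase_mem_unitary _) ++ cx c a ++
    oneQubit a (phase (-(Real.pi / 4))) (phase_mem_unitary _) ++
    oneQubit a hadamard hadamard_mem_unitary

theorem eval_halfToffoliCircuit {c a : Q} (h : c ≠ a) :
    (halfToffoliCircuit c a).eval = ucOp a fun y => halfToffoli (y c) := by
  simp only [halfToffoliCircuit, Circuit.eval_append, eval_oneQubit, eval_cx h, ucOp_mul]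
  refine ucOp_congr fun y => ?_
  simp only [halfToffoli, mul_assoc]

/-- For controls `c₁, …, c_m` and dirty ancillas `a₁, …, a_{m-1}`, a circuit that adds to the bit of
`a₁` the product of the bits of the controls, up to phases and up to changes of the other
ancillas. -/
def toggle : List Q → List Q → Circuit Q
  | [c, c'], [a] => (halfToffoliCircuit c a).inv ++ cx c' a ++ halfToffoliCircuit c a
  | c :: cs, a :: a' :: as =>
    (halfToffoliCircuit c a).inv ++ cx a' a ++ toggle cs (a' :: as) ++ cx a' a ++
      halfToffoliCircuit c a
  | _, _ => []

/-- `V` is a weighted classical map that adds the product of the bits of `cs` to the bit `a`, and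
changes no bit outside `as`. -/
def IsToggle (V : Op Q) (cs as : List Q) (a : Q) : Prop :=
  ∃ (p : (Q → Fin 2) → ℂ) (τ : (Q → Fin 2) → Q → Fin 2), V = monoOp p τ ∧
    Function.Involutive τ ∧
    (∀ t, t ∉ cs → t ∉ as → ∀ y b,
      p (Function.update y t b) = p y ∧ τ (Function.update y t b) = Function.update (τ y) t b) ∧
    (∀ y q, q ∉ as → τ y q = y q) ∧
    ∀ y, τ y a = y a + (cs.map y).prod

theorem map_update_prod {cs : List Q} {t : Q} (ht : t ∉ cs) (y : Q → Fin 2) (b : Fin 2) :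
    (cs.map (Function.update y t b)).prod = (cs.map y).prod := by
  congr 1
  refine List.map_congr_left fun c hc => ?_
  rw [Function.update_of_ne (ne_of_mem_of_not_mem hc ht)]

/-- Adding one control: by `halfToffoli_conj_apply` the new factor is monomial and shifts the bit
`a` by `y c * ∏ cs`. This shift reads only bits that `τ` fixes and writes a bit that `τ` ignores, so
it commutes with `τ` and the composite is again an involution. -/
theorem isToggle_ucOp_mul {c a : Q} {cs as : List Q} {p : (Q → Fin 2) → ℂ}
    {τ : (Q → Fin 2) → Q → Fin 2} (hτ : Function.Involutive τ)
    (hloc : ∀ t, t ∉ cs → t ∉ as → ∀ y b,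
      p (Function.update y t b) = p y ∧ τ (Function.update y t b) = Function.update (τ y) t b)
    (hfix : ∀ y q, q ∉ as → τ y q = y q) (hca : c ≠ a) (hcas : c ∉ as) (hacs : a ∉ cs)
    (haas : a ∉ as) (hdisj : ∀ q ∈ cs, q ∉ as) :
    IsToggle (ucOp a (fun y => halfToffoli (y c) * bitX (cs.map y).prod * (halfToffoli (y c))ᴴ) *
      monoOp p τ) (c :: cs) (a :: as) a := by
  have hprod : ∀ y, (cs.map (τ y)).prod = (cs.map y).prod := fun y => by
    congr 1
    exact List.map_congr_left fun q hq => hfix y q (hdisj q hq)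
  obtain ⟨G, hG⟩ : ∃ G : (Q → Fin 2) → Matrix (Fin 2) (Fin 2) ℂ, G = fun y =>
    halfToffoli (y c) * bitX (cs.map y).prod * (halfToffoli (y c))ᴴ := ⟨_, rfl⟩
  have hGt : ∀ t, t ≠ c → t ∉ cs → ∀ y b, G (Function.update y t b) = G y := by
    intro t htc htcs y b
    simp only [hG, map_update_prod htcs, Function.update_of_ne htc.symm]
  have hGz : ∀ y i k, i ≠ k + y c * (cs.map y).prod → G y i k = 0 := by
    intro y i k h
    rw [hG]
    exact halfToffoli_conj_apply _ _ _ _ h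
  rw [← hG]
  clear hG
  rw [ucOp_eq_monoOp (f := fun y => y c * (cs.map y).prod) _ hGz, monoOp_mul]
  · refine ⟨_, _, rfl, ?_, ?_, ?_, ?_⟩
    · intro y
      have h1 : ∀ y b, τ (Function.update y a b) = Function.update (τ y) a b :=
        fun y b => (hloc a hacs haas y b).2
      simp only [Function.comp_apply, h1, hτ y, Function.update_idem, Function.update_of_ne hca,
        hprod, map_update_prod hacs, Function.update_self, hfix y c hcas, hfix y a haas, add_assoc]
      have h2 : ∀ b : Fin 2, b + b = 0 := by decide
      rw [h2, add_zero, Function.update_eq_self]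
    · intro t ht htas y b
      simp only [List.mem_cons, not_or] at ht htas
      obtain ⟨h1, h2⟩ := hloc t ht.2 htas.2 y b
      have hc : Function.update (τ y) t b c = τ y c := Function.update_of_ne (Ne.symm ht.1) _ _
      have ha : Function.update (τ y) t b a = τ y a := Function.update_of_ne (Ne.symm htas.1) _ _
      constructor
      · simp only [h1, h2, hc, ha, map_update_prod ht.2]
        rw [Function.update_comm htas.1, hGt t ht.1 ht.2]
      · simp only [Function.comp_apply, h2, hc, ha, map_update_prod ht.2]
        rw [Function.update_comm htas.1]
    · intro y q hq
      simp only [List.mem_cons, not_or] at hq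
      simp [Function.update_of_ne hq.1, hfix y q hq.2]
    · intro y
      simp [hfix y a haas, hfix y c hcas, hprod]
  · intro y b
    rw [Function.update_of_ne hca, map_update_prod hacs]

theorem isToggle_toggle : ∀ (cs : List Q) (a : Q) (as : List Q), (cs ++ a :: as).Nodup →
    as.length + 2 = cs.length → IsToggle (toggle cs (a :: as)).eval cs (a :: as) a
  | [c, c'], a, [], hn, _ => by
    simp only [List.cons_append, List.nil_append, List.nodup_cons, List.mem_cons, not_or] at hn
    have hca : c ≠ a := hn.1.2.1
    have hca' : c' ≠ a := hn.2.1.1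
    have := isToggle_ucOp_mul (c := c) (a := a) (cs := [c']) (as := []) (p := fun _ => 1)
      (τ := id) (fun _ => rfl) (fun _ _ _ _ _ => ⟨rfl, rfl⟩) (fun _ _ _ => rfl) hca (by simp)
      (by simpa using hca'.symm) (by simp) (by simp)
    rw [monoOp_one, mul_one] at this
    simp only [toggle, Circuit.eval_append, Circuit.eval_inv, eval_halfToffoliCircuit hca,
      eval_cx hca', ucOp_conjTranspose, ucOp_mul]
    simpa [mul_assoc] using this
  | c :: cs, a, a' :: as, hn, hl => by
    have hn' : (cs ++ a' :: as).Nodup := by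
      refine hn.sublist ?_
      simp only [List.cons_append]
      exact List.Sublist.cons _ ((List.Sublist.refl cs).append (List.sublist_cons_self _ _))
    obtain ⟨p, τ, hV, hτ, hloc, hfix, hadd⟩ :=
      isToggle_toggle cs a' as hn' (by simpa using hl)
    simp only [List.cons_append, List.nodup_cons, List.mem_append, List.mem_cons, not_or,
      List.nodup_append, ne_eq] at hn
    obtain ⟨⟨hccs, hca, hca', hcas⟩, -, ⟨⟨haa', haas⟩, -, -⟩, hd⟩ := hn
    have hacs : a ∉ cs := fun h => hd a h a (Or.inl rfl) rfl
    have hmem : a ∉ a' :: as := by simp [haa', haas]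
    have key := isToggle_ucOp_mul (c := c) (a := a) hτ hloc hfix hca (by simp [hca', hcas]) hacs
      hmem (fun q hq hq' => hd q hq q (Or.inr (by simpa using hq')) rfl)
    have hl' : toggle (c :: cs) (a :: a' :: as) = (halfToffoliCircuit c a).inv ++ cx a' a ++
        toggle cs (a' :: as) ++ cx a' a ++ halfToffoliCircuit c a := by
      rw [toggle]
    have heval : (toggle (c :: cs) (a :: a' :: as)).eval =
        ucOp a (fun y => halfToffoli (y c) * bitX (cs.map y).prod * (halfToffoli (y c))ᴴ) *
          monoOp p τ := by
      have hc : ∀ y, τ y c = y c := fun y => hfix y c (by simp [hca', hcas])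
      simp only [hl', Circuit.eval_append, Circuit.eval_inv, eval_halfToffoliCircuit hca,
        eval_cx (Ne.symm haa'), ucOp_conjTranspose, hV]
      -- Pulling the inner toggle through to the right leaves two CNOT exponents, `y a'` and `y a' +
      -- ∏ cs`. The unknown ancilla bit cancels, and `∏ cs` remains as the middle factor of the
      -- conjugation.
      rw [ucOp_mul, monoOp_mul_ucOp hτ (fun y b => (hloc a hacs hmem y b).1)
        (fun y b => (hloc a hacs hmem y b).2), ← mul_assoc, ← mul_assoc, ucOp_mul, ucOp_mul]
      congr 1
      refine ucOp_congr fun y => ?_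
      rw [hadd, hc, mul_assoc, ← mul_assoc (bitX _) (bitX _), bitX_mul, ← add_assoc]
      have h2 : ∀ b : Fin 2, b + b = 0 := by decide
      rw [h2, zero_add, mul_assoc]
    rw [heval]
    exact key
  | [], _, [], _, hl => by simp at hl
  | [_], _, [], _, hl => by simp at hl
  | _ :: _ :: _ :: _, _, [], _, hl => by simp at hl
  | [], _, _ :: _, _, hl => by simp at hl

end Toggle

/-! ### Multi-controlled gates as group commutators. -/

section Commutator

theorem rz_mul (a b : ℝ) : rz a * rz b = rz (a + b) := by
  ext i k
  fin_cases i <;> fin_cases k <;> simp [rz, Matrix.mul_apply, ← Complex.exp_add] <;>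
    congr 1 <;> ring

theorem rz_zero : rz 0 = 1 := by
  ext i k
  fin_cases i <;> fin_cases k <;> simp [rz]

theorem pauliX_mul_rz (a : ℝ) : pauliX * rz a = rz (-a) * pauliX := by
  ext i k
  fin_cases i <;> fin_cases k <;> simp [rz, pauliX, Matrix.mul_apply, neg_div]

theorem rz_pi_conj : hadamard * rz Real.pi * hadamard = (-Complex.I) • pauliX := by
  have h : Complex.exp (Complex.I * (Real.pi : ℂ) / 2) = Complex.I := by
    refine Eq.trans (congrArg Complex.exp ?_) Complex.exp_pi_div_two_mul_I
    ring
  have h' : Complex.exp (-(Complex.I * (Real.pi : ℂ) / 2)) = -Complex.I := by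
    rw [Complex.exp_neg, h, Complex.inv_I]
  rw [hadamard_conj]
  ext i k
  fin_cases i <;> fin_cases k <;> simp [rz, pauliX, h, h'] <;> ring

/-- `M` is the matrix `X ^ b` up to a phase factor. -/
def IsPhaseX (b : Fin 2) (M : Matrix (Fin 2) (Fin 2) ℂ) : Prop :=
  ∃ z : ℂ, z * star z = 1 ∧ M = z • bitX b

theorem isPhaseX_bitX (b : Fin 2) : IsPhaseX b (bitX b) := ⟨1, by simp, by simp⟩

theorem IsPhaseX.mul_conjTranspose {a b : Fin 2} {M N : Matrix (Fin 2) (Fin 2) ℂ}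
    (hM : IsPhaseX a M) (hN : IsPhaseX b N) : IsPhaseX (a + b) (M * Nᴴ) := by
  obtain ⟨z, hz, rfl⟩ := hM
  obtain ⟨w, hw, rfl⟩ := hN
  refine ⟨z * star w, ?_, ?_⟩
  · rw [star_mul, star_star]
    calc z * star w * (w * star z) = (z * star z) * (w * star w) := by ring
      _ = 1 := by rw [hz, hw, one_mul]
  · rw [Matrix.conjTranspose_smul, bitX_conjTranspose, Matrix.smul_mul, Matrix.mul_smul, smul_smul,
      bitX_mul]

/-- The phases cancel because `M` and `N` each occur together with their adjoint. If `a` or `b` is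
zero the rotations cancel in pairs. If both are one, `X` inverts the sign of a rotation and the four
quarter rotations add up to `θ`. -/
theorem commutator_eq {a b : Fin 2} {M N : Matrix (Fin 2) (Fin 2) ℂ} (hM : IsPhaseX a M)
    (hN : IsPhaseX b N) (θ : ℝ) :
    rz (θ / 4) * (M * (rz (-(θ / 4)) * (N * (rz (θ / 4) * (Mᴴ * (rz (-(θ / 4)) * Nᴴ)))))) =
      if a * b = 1 then rz θ else 1 := by
  obtain ⟨z, hz, rfl⟩ := hM
  obtain ⟨w, hw, rfl⟩ := hN
  have hzw : star w * star z * w * z = 1 := by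
    calc _ = (z * star z) * (w * star w) := by ring
      _ = 1 := by rw [hz, hw, one_mul]
  simp only [Matrix.conjTranspose_smul, bitX_conjTranspose, Matrix.smul_mul, Matrix.mul_smul,
    smul_smul]
  rw [hzw, one_smul]
  have hr : ∀ x : ℝ, ∀ A, rz x * (rz (-x) * A) = A := fun x A => by
    rw [← mul_assoc, rz_mul, add_neg_cancel, rz_zero, one_mul]
  have hr' : ∀ x : ℝ, ∀ A, rz (-x) * (rz x * A) = A := fun x A => by
    rw [← mul_assoc, rz_mul, neg_add_cancel, rz_zero, one_mul]
  have hX : ∀ x : ℝ, ∀ A, pauliX * (rz x * A) = rz (-x) * (pauliX * A) := fun x A => by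
    rw [← mul_assoc, pauliX_mul_rz, mul_assoc]
  have hXX : ∀ A, pauliX * (pauliX * A) = A := fun A => by
    rw [← mul_assoc, pauliX_mul_self, one_mul]
  have hRR : ∀ x y : ℝ, ∀ A, rz x * (rz y * A) = rz (x + y) * A := fun x y A => by
    rw [← mul_assoc, rz_mul]
  obtain rfl | rfl : a = 0 ∨ a = 1 := by omega
  · simp [hr, bitX_mul_self, rz_mul, rz_zero]
  obtain rfl | rfl : b = 0 ∨ b = 1 := by omega
  · have : rz (θ / 4) * (pauliX * (pauliX * rz (-(θ / 4)))) = 1 := by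
      rw [hXX, rz_mul, add_neg_cancel, rz_zero]
    simp [hr', this]
  · have : rz (θ / 4) * (pauliX * (rz (-(θ / 4)) * (pauliX * (rz (θ / 4) * (pauliX *
        (rz (-(θ / 4)) * pauliX)))))) = rz θ := by
      simp only [hX, neg_neg, hXX, hRR]
      rw [pauliX_mul_self, mul_one]
      congr 1
      ring
    simp [this]

variable {Q : Type} [Fintype Q] [DecidableEq Q]

/-- The commutator circuit `A† P A P' A† P† A P'†` with `A = exp(i θ Z / 8)` on qubit `t`. If both
`P` and `P'` act as `X` on qubit `t`, it is the rotation by `θ`; if one of them acts trivially, so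
does the commutator. -/
def commutatorCircuit (t : Q) (P P' : Circuit Q) (θ : ℝ) : Circuit Q :=
  P'.inv ++ oneQubit t (rz (-(θ / 4))) (rz_mem_unitary _) ++ P.inv ++
    oneQubit t (rz (θ / 4)) (rz_mem_unitary _) ++ P' ++
    oneQubit t (rz (-(θ / 4))) (rz_mem_unitary _) ++ P ++
    oneQubit t (rz (θ / 4)) (rz_mem_unitary _)

theorem eval_commutatorCircuit {t : Q} {P P' : Circuit Q}
    {F F' : (Q → Fin 2) → Matrix (Fin 2) (Fin 2) ℂ} (hP : P.eval = ucOp t F)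
    (hP' : P'.eval = ucOp t F') {b b' : (Q → Fin 2) → Fin 2} (hF : ∀ y, IsPhaseX (b y) (F y))
    (hF' : ∀ y, IsPhaseX (b' y) (F' y)) (θ : ℝ) :
    (commutatorCircuit t P P' θ).eval = ucOp t fun y => if b y * b' y = 1 then rz θ else 1 := by
  simp only [commutatorCircuit, Circuit.eval_append, Circuit.eval_inv, eval_oneQubit, hP, hP',
    ucOp_conjTranspose, ucOp_mul]
  exact ucOp_congr fun y => commutator_eq (hF y) (hF' y) θ

theorem cnotCount_commutatorCircuit (t : Q) (P P' : Circuit Q) (θ : ℝ) :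
    (commutatorCircuit t P P' θ).cnotCount = 2 * P.cnotCount + 2 * P'.cnotCount := by
  simp only [commutatorCircuit, Circuit.cnotCount_append, Circuit.cnotCount_inv,
    cnotCount_oneQubit]
  omega

/-- The `-iX` gate on qubit `t` with controls `c` and `c'`. -/
def ccixCircuit (c c' t : Q) : Circuit Q :=
  oneQubit t hadamard hadamard_mem_unitary ++ commutatorCircuit t (cx c t) (cx c' t) Real.pi ++
    oneQubit t hadamard hadamard_mem_unitary

/-- With CNOTs as the two `X` gates the commutator is a doubly controlled `rz π = -iZ`, which the
Hadamard gates turn into `-iX`. -/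
theorem eval_ccixCircuit {c c' t : Q} (h : c ≠ t) (h' : c' ≠ t) :
    (ccixCircuit c c' t).eval =
      ucOp t fun y => if y c * y c' = 1 then (-Complex.I) • pauliX else 1 := by
  simp only [ccixCircuit, Circuit.eval_append, eval_oneQubit,
    eval_commutatorCircuit (eval_cx h) (eval_cx h') (fun y => isPhaseX_bitX (y c))
      (fun y => isPhaseX_bitX (y c')), ucOp_mul]
  refine ucOp_congr fun y => ?_
  split_ifs
  · rw [← mul_assoc, rz_pi_conj]
  · rw [one_mul, hadamard_mul_self]

theorem isPhaseX_ite (b : Fin 2) : IsPhaseX b (if b = 1 then (-Complex.I) • pauliX else 1) := by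
  obtain rfl | rfl : b = 0 ∨ b = 1 := by omega
  · simpa using isPhaseX_bitX 0
  · exact ⟨-Complex.I, by simp, by simp⟩

theorem cnotCount_ccixCircuit {c c' t : Q} (h : c ≠ t) (h' : c' ≠ t) :
    (ccixCircuit c c' t).cnotCount = 4 := by
  simp [ccixCircuit, cnotCount_commutatorCircuit, cnotCount_cx h, cnotCount_cx h']

theorem cnotCount_halfToffoliCircuit {c a : Q} (h : c ≠ a) :
    (halfToffoliCircuit c a).cnotCount = 1 := by
  simp [halfToffoliCircuit, cnotCount_cx h]

/-- Two controls need three CNOTs; each further control adds two in the half Toffoli gates and two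
from the neighbouring ancilla. -/
theorem cnotCount_toggle : ∀ (cs : List Q) (a : Q) (as : List Q), (cs ++ a :: as).Nodup →
    as.length + 2 = cs.length → (toggle cs (a :: as)).cnotCount + 5 = 4 * cs.length
  | [c, c'], a, [], hn, _ => by
    simp only [List.cons_append, List.nil_append, List.nodup_cons, List.mem_cons, not_or] at hn
    simp [toggle, Circuit.cnotCount_inv, cnotCount_halfToffoliCircuit (c := c) (a := a) hn.1.2.1,
      cnotCount_cx (c := c') (t := a) hn.2.1.1]
  | c :: cs, a, a' :: as, hn, hl => by
    have hn' : (cs ++ a' :: as).Nodup := by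
      refine hn.sublist ?_
      simp only [List.cons_append]
      exact List.Sublist.cons _ ((List.Sublist.refl cs).append (List.sublist_cons_self _ _))
    have ih := cnotCount_toggle cs a' as hn' (by simpa using hl)
    simp only [List.cons_append, List.nodup_cons, List.mem_append, List.mem_cons, not_or,
      List.nodup_append, ne_eq] at hn
    have hl' : toggle (c :: cs) (a :: a' :: as) = (halfToffoliCircuit c a).inv ++ cx a' a ++
        toggle cs (a' :: as) ++ cx a' a ++ halfToffoliCircuit c a := by
      rw [toggle]
    simp only [hl', Circuit.cnotCount_append, Circuit.cnotCount_inv,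
      cnotCount_halfToffoliCircuit hn.1.2.1, cnotCount_cx (Ne.symm hn.2.2.1.1.1),
      List.length_cons]
    omega
  | [], _, [], _, hl => by simp at hl
  | [_], _, [], _, hl => by simp at hl
  | _ :: _ :: _ :: _, _, [], _, hl => by simp at hl
  | [], _, _ :: _, _, hl => by simp at hl

/-- The multi-controlled `X` gate on qubit `t` with the controls `cs`, up to a diagonal gate on the
other qubits. It borrows the dirty ancillas `as`, two less than there are controls. -/
def mcxCircuit (t : Q) : List Q → List Q → Circuit Q
  | [], _ => oneQubit t pauliX pauliX_mem_unitary
  | [c], _ => cx c t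
  | [c, c'], _ => ccixCircuit c c' t
  | c :: cs, a :: as =>
    (toggle cs (a :: as)).inv ++ (ccixCircuit c a t).inv ++ toggle cs (a :: as) ++
      ccixCircuit c a t
  | _, [] => []

/-- The number of CNOT gates of `mcxCircuit` with `k` controls. -/
def mcxCount : ℕ → ℕ
  | 0 => 0
  | 1 => 1
  | 2 => 4
  | k + 3 => 8 * k + 14

/-- From three controls on, with `V` the toggle that adds `∏ cs` to `a`, the circuit is `G V G† V†`
where `G` is the `-iX` gate controlled by `c` and `a`. Its target exponent is `c a + c (a + ∏ cs) =
c ∏ cs`, whatever the ancilla holds, and `V V† = 1` restores the ancillas and removes the phases of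
`V`. For `k + 3` controls the count is `2 (4 (k + 2) - 5) + 2 * 4 = 8 k + 14`. -/
theorem mcxCircuit_spec (t : Q) (cs as : List Q) (hn : (t :: (cs ++ as)).Nodup)
    (hl : as.length = cs.length - 2) :
    (∃ F : (Q → Fin 2) → Matrix (Fin 2) (Fin 2) ℂ, (mcxCircuit t cs as).eval = ucOp t F ∧
      ∀ y, IsPhaseX (cs.map y).prod (F y)) ∧
    (mcxCircuit t cs as).cnotCount = mcxCount cs.length := by
  match cs, as, hl with
  | [], _, _ =>
    refine ⟨⟨_, by rw [mcxCircuit, eval_oneQubit], fun y => ?_⟩, by simp [mcxCircuit, mcxCount]⟩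
    exact isPhaseX_bitX 1
  | [c], _, _ =>
    have hct : c ≠ t := by rintro rfl; simp at hn
    refine ⟨⟨_, by rw [mcxCircuit, eval_cx hct], fun y => ?_⟩,
      by simp [mcxCircuit, mcxCount, cnotCount_cx hct]⟩
    simpa using isPhaseX_bitX (y c)
  | [c, c'], _, _ =>
    have hct : c ≠ t := by rintro rfl; simp at hn
    have hct' : c' ≠ t := by rintro rfl; simp at hn
    refine ⟨⟨_, by rw [mcxCircuit, eval_ccixCircuit hct hct'], fun y => ?_⟩,
      by simp [mcxCircuit, mcxCount, cnotCount_ccixCircuit hct hct']⟩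
    simpa using isPhaseX_ite (y c * y c')
  | c :: c₁ :: c₂ :: cs, a :: as, hl =>
    rw [List.nodup_cons] at hn
    obtain ⟨ht, hn⟩ := hn
    have hcn : c ∉ (c₁ :: c₂ :: cs) ++ a :: as := (List.nodup_cons.mp hn).1
    have hn' : ((c₁ :: c₂ :: cs) ++ a :: as).Nodup := (List.nodup_cons.mp hn).2
    have hl' : as.length + 2 = (c₁ :: c₂ :: cs).length := by simp at hl ⊢; omega
    have hcirc : mcxCircuit t (c :: c₁ :: c₂ :: cs) (a :: as) =
        (toggle (c₁ :: c₂ :: cs) (a :: as)).inv ++ (ccixCircuit c a t).inv ++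
          toggle (c₁ :: c₂ :: cs) (a :: as) ++ ccixCircuit c a t := by
      rw [mcxCircuit] <;> simp
    have hct : c ≠ t := by rintro rfl; simp at ht
    have hat : a ≠ t := by rintro rfl; simp at ht
    constructor
    · obtain ⟨p, τ, hV, hτ, hloc, hfix, hadd⟩ := isToggle_toggle _ a as hn' hl'
      have htl := hloc t (by simp at ht ⊢; tauto) (by simp at ht ⊢; tauto)
      have hunit := (toggle (c₁ :: c₂ :: cs) (a :: as)).eval_mul_conjTranspose
      have hc : ∀ y, τ y c = y c := fun y => hfix y c fun h => hcn (List.mem_append_right _ h)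
      -- The second factor is the inverse `-iX` gate seen after pulling `V` through it, so it is
      -- controlled by the toggled bits.
      refine ⟨fun y => (if y c * y a = 1 then (-Complex.I) • pauliX else 1) *
        (if τ y c * τ y a = 1 then (-Complex.I) • pauliX else 1)ᴴ, ?_, ?_⟩
      · rw [hcirc]
        simp only [Circuit.eval_append, Circuit.eval_inv, eval_ccixCircuit hct hat,
          ucOp_conjTranspose]
        rw [← mul_assoc (toggle _ _).eval, hV,
          monoOp_mul_ucOp hτ (fun y b => (htl y b).1) (fun y b => (htl y b).2), mul_assoc, ← hV,
          hunit, mul_one, ucOp_mul]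
      · intro y
        have := (isPhaseX_ite (y c * y a)).mul_conjTranspose (isPhaseX_ite (τ y c * τ y a))
        convert this using 1
        rw [hc, hadd, mul_add, ← add_assoc, List.map_cons, List.prod_cons]
        have h2 : ∀ b : Fin 2, b + b = 0 := by decide
        rw [h2, zero_add]
    · have := cnotCount_toggle _ a as hn' hl'
      simp only [List.length_cons] at this
      simp only [hcirc, Circuit.cnotCount_append, Circuit.cnotCount_inv,
        cnotCount_ccixCircuit hct hat, List.length_cons, mcxCount]
      omega
  | _ :: _ :: _ :: _, [], hl => simp at hl

/-- The rotation `rz θ` of qubit `t` controlled by all qubits of the list `L`: a commutator of two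
multi-controlled `X` gates, each of which is controlled by one half of `L` and borrows its ancillas
from the other half. -/
def controlledRZ (t : Q) (L : List Q) (θ : ℝ) : Circuit Q :=
  commutatorCircuit t
    (mcxCircuit t (L.take ((L.length + 1) / 2))
      ((L.drop ((L.length + 1) / 2)).take ((L.take ((L.length + 1) / 2)).length - 2)))
    (mcxCircuit t (L.drop ((L.length + 1) / 2))
      ((L.take ((L.length + 1) / 2)).take ((L.drop ((L.length + 1) / 2)).length - 2))) θ

theorem controlledRZ_spec (t : Q) (L : List Q) (hn : (t :: L).Nodup) (θ : ℝ) :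
    (controlledRZ t L θ).eval = (ucOp t fun y => if (L.map y).prod = 1 then rz θ else 1) ∧
    (controlledRZ t L θ).cnotCount =
      2 * mcxCount ((L.length + 1) / 2) + 2 * mcxCount (L.length / 2) := by
  set h := (L.length + 1) / 2 with hh
  have hL : L.take h ++ L.drop h = L := List.take_append_drop h L
  have hlen1 : (L.take h).length = h := by simp [hh]; omega
  have hlen2 : (L.drop h).length = L.length / 2 := by simp [hh]; omega
  have hperm : (L.drop h ++ L.take h).Perm L :=
    List.perm_append_comm.trans (by rw [hL])
  -- The other half always holds enough ancillas, since `⌈m/2⌉ - 2 ≤ ⌊m/2⌋` for `m` controls.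
  have h1 := mcxCircuit_spec t (L.take h) ((L.drop h).take ((L.take h).length - 2))
    (hn.sublist (List.Sublist.cons_cons t (by
      conv_rhs => rw [← hL]
      exact (List.Sublist.refl _).append (List.take_sublist _ _)))) (by
      rw [List.length_take, hlen1, hlen2]; omega)
  have h2 := mcxCircuit_spec t (L.drop h) ((L.take h).take ((L.drop h).length - 2))
    (((hperm.cons t).nodup_iff.mpr hn).sublist (List.Sublist.cons_cons t
      ((List.Sublist.refl _).append (List.take_sublist _ _)))) (by
      rw [List.length_take, hlen1, hlen2]; omega)
  obtain ⟨⟨F, hF, hFX⟩, hFc⟩ := h1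
  obtain ⟨⟨G, hG, hGX⟩, hGc⟩ := h2
  constructor
  · rw [controlledRZ, ← hh, eval_commutatorCircuit hF hG hFX hGX]
    refine ucOp_congr fun y => ?_
    rw [← List.prod_append, ← List.map_append, hL]
  · rw [controlledRZ, ← hh, cnotCount_commutatorCircuit, hFc, hGc, hlen1, hlen2]

end Commutator

/-! ### The circuit for one time step on one axis and its size. -/

section StepCircuit

variable {n : ℕ}

theorem tensorQubits_diagonal {Q : Type} [Fintype Q] [DecidableEq Q] (v : Q → Fin 2 → ℂ) :
    tensorQubits (fun q => Matrix.diagonal (v q)) = Matrix.diagonal fun y => ∏ q, v q (y q) := by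
  ext x y
  simp only [tensorQubits, Matrix.of_apply, Matrix.diagonal_apply, Finset.prod_ite_zero,
    funext_iff, Finset.mem_univ, true_implies]

theorem prod_controls (j : Fin n) (r : Fin 2 → ℂ) (y : Fin n → Fin 2) :
    ∏ k, (if k < j then ![0, 1] else if k = j then r else 1 : Fin 2 → ℂ) (y k) =
      if ∀ k < j, y k = 1 then r (y j) else 0 := by
  split_ifs with h
  · rw [Finset.prod_eq_single j]
    · simp
    · intro k _ hk
      by_cases hkj : k < j
      · simp [hkj, h k hkj]
      · simp [hkj, hk]
    · simp
  · push Not at h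
    obtain ⟨k, hk, hy⟩ := h
    refine Finset.prod_eq_zero (Finset.mem_univ k) ?_
    have : y k = 0 := by omega
    simp [hk, this]

theorem tensorQubits_controls (j : Fin n) (r : Fin 2 → ℂ) :
    tensorQubits (fun k => if k < j then sigma11 else if k = j then Matrix.diagonal r else 1) =
      Matrix.diagonal fun y : Fin n → Fin 2 => if ∀ k < j, y k = 1 then r (y j) else 0 := by
  have h11 : sigma11 = Matrix.diagonal ![0, 1] := by
    ext a b; fin_cases a <;> fin_cases b <;> simp [sigma11]
  have h : (fun k => if k < j then sigma11 else if k = j then Matrix.diagonal r else 1) =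
      fun k => Matrix.diagonal (if k < j then ![0, 1] else if k = j then r else 1) := by
    funext k
    split_ifs <;> simp [h11]
  rw [h, tensorQubits_diagonal]
  simp only [prod_controls]

theorem rz_eq_diagonal (θ : ℝ) : rz θ = Matrix.diagonal
    ![Complex.exp (-(Complex.I * θ / 2)), Complex.exp (Complex.I * θ / 2)] := by
  ext a b; fin_cases a <;> fin_cases b <;> simp [rz]

theorem mcRZ_eq_diagonal (j : Fin n) (θ : ℝ) :
    mcRZ j θ = Matrix.diagonal fun y : Fin n → Fin 2 =>
      if ∀ k < j, y k = 1 then rz θ (y j) (y j) else 1 := by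
  have h1 := tensorQubits_controls j (1 : Fin 2 → ℂ)
  simp only [Pi.one_def, Matrix.diagonal_one, ite_self] at h1
  rw [mcRZ, h1, rz_eq_diagonal, tensorQubits_controls, ← Matrix.diagonal_one,
    Matrix.diagonal_sub, Matrix.diagonal_add]
  congr 1
  funext y
  split_ifs <;> simp

theorem ucOp_eq_diagonal {Q : Type} [Fintype Q] [DecidableEq Q] (t : Q)
    (v : (Q → Fin 2) → Fin 2 → ℂ) :
    ucOp t (fun y => Matrix.diagonal (v y)) =
      Matrix.diagonal fun y => v (Function.update y t 0) (y t) := by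
  ext x y
  simp only [ucOp, Matrix.of_apply, Matrix.diagonal_apply]
  by_cases h : x = y
  · simp [h]
  · rw [if_neg h]
    by_cases h1 : Function.update x t 0 = Function.update y t 0
    · rw [if_pos h1, if_neg fun h2 => h (eq_of_update_eq h1 h2)]
    · rw [if_neg h1]

/-- The qubits below `j`. -/
def below (j : Fin n) : List (Fin n) := (List.finRange n).filter (· < j)

theorem mem_below {j k : Fin n} : k ∈ below j ↔ k < j := by simp [below]

theorem nodup_below (j : Fin n) : (j :: below j).Nodup :=
  List.nodup_cons.mpr ⟨by simp [mem_below], (List.nodup_finRange n).filter _⟩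

theorem length_below (j : Fin n) : (below j).length = j := by
  rw [← List.toFinset_card_of_nodup (List.nodup_cons.mp (nodup_below j)).2, ← Fin.card_Iio]
  congr 1
  ext k
  simp [mem_below]

theorem prod_eq_one_iff {Q : Type} (y : Q → Fin 2) (L : List Q) :
    (L.map y).prod = 1 ↔ ∀ k ∈ L, y k = 1 := by
  induction L with
  | nil => simp
  | cons a L ih =>
    rw [List.map_cons, List.prod_cons, List.forall_mem_cons, ← ih]
    generalize (L.map y).prod = b
    generalize y a = c
    revert b c
    decide

theorem ucOp_controls_eq_mcRZ (j : Fin n) (θ : ℝ) :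
    (ucOp j fun y => if ((below j).map y).prod = 1 then rz θ else 1) = mcRZ j θ := by
  have h : (fun y : Fin n → Fin 2 => if ((below j).map y).prod = 1 then rz θ else 1) =
      fun y => Matrix.diagonal fun b => if ∀ k < j, y k = 1 then rz θ b b else 1 := by
    funext y
    simp only [prod_eq_one_iff, mem_below]
    split_ifs
    · ext a b; fin_cases a <;> fin_cases b <;> simp [rz]
    · rw [Matrix.diagonal_one]
  rw [h, ucOp_eq_diagonal, mcRZ_eq_diagonal]
  congr 1
  funext y
  have : (∀ k < j, Function.update y j 0 k = 1) ↔ ∀ k < j, y k = 1 :=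
    forall₂_congr fun k hk => by rw [Function.update_of_ne hk.ne]
  simp only [this]

/-- The circuit for `bellU`. -/
def bellCircuit (j : Fin n) (lam : ℝ) : Circuit (Fin n) :=
  oneQubit j hadamard hadamard_mem_unitary ++ oneQubit j (phase lam) (phase_mem_unitary _) ++
    ((below j).reverse.map (cx j)).flatten

theorem eval_bellCircuit (j : Fin n) (lam : ℝ) : (bellCircuit j lam).eval = bellU j lam := by
  simp only [bellCircuit, Circuit.eval_append, eval_oneQubit, Circuit.eval_flatten, bellU,
    onQubit_eq_ucOp, ← mul_assoc]
  congr 3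
  rw [← List.map_reverse, List.reverse_reverse, List.map_map]
  refine List.map_congr_left fun m hm => ?_
  have hm : m < j := mem_below.mp hm
  simp only [Function.comp_apply]
  rw [eval_cx hm.ne', cnotOp_eq_ucOp_bitX hm.ne']

theorem cnotCount_bellCircuit (j : Fin n) (lam : ℝ) : (bellCircuit j lam).cnotCount = j := by
  simp only [bellCircuit, Circuit.cnotCount_append, Circuit.cnotCount_flatten,
    cnotCount_oneQubit, List.map_map]
  rw [List.map_congr_left (g := fun _ => 1)]
  · simp [length_below]
  · intro m hm
    exact cnotCount_cx (mem_below.mp (List.mem_reverse.mp hm)).ne'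

theorem bellU_mul_conjTranspose (j : Fin n) (lam : ℝ) : bellU j lam * (bellU j lam)ᴴ = 1 := by
  rw [← eval_bellCircuit]
  exact Circuit.eval_mul_conjTranspose _

/-- The circuit for `stepW`. -/
def stepWCircuit (j : Fin n) (φ lam : ℝ) : Circuit (Fin n) :=
  (bellCircuit j (-lam)).inv ++ controlledRZ j (below j) (2 * φ) ++ bellCircuit j (-lam)

theorem eval_stepWCircuit (j : Fin n) (φ lam : ℝ) :
    (stepWCircuit j φ lam).eval = stepW j φ lam := by
  simp only [stepWCircuit, Circuit.eval_append, Circuit.eval_inv, eval_bellCircuit,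
    (controlledRZ_spec j (below j) (nodup_below j) _).1, ucOp_controls_eq_mcRZ, stepW, mul_assoc]

theorem cnotCount_stepWCircuit (j : Fin n) (φ lam : ℝ) :
    (stepWCircuit j φ lam).cnotCount =
      2 * j + 2 * mcxCount ((j + 1) / 2) + 2 * mcxCount (j / 2) := by
  simp only [stepWCircuit, Circuit.cnotCount_append, Circuit.cnotCount_inv, cnotCount_bellCircuit,
    (controlledRZ_spec j (below j) (nodup_below j) _).2, length_below]
  omega

/-- The circuit for `stepV`. -/
def stepVCircuit (n : ℕ) (φ lam : ℝ) : Circuit (Fin n) :=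
  ((List.finRange n).reverse.map fun j => stepWCircuit j φ lam).flatten

theorem eval_stepVCircuit (n : ℕ) (φ lam : ℝ) :
    (stepVCircuit n φ lam).eval = stepV n φ lam := by
  simp only [stepVCircuit, Circuit.eval_flatten, stepV, ← List.map_reverse, List.reverse_reverse,
    List.map_map]
  congr 1
  exact List.map_congr_left fun j _ => eval_stepWCircuit j φ lam

/-- The number of CNOT gates of `stepVCircuit`. -/
def stepCount (n : ℕ) : ℕ :=
  ∑ j ∈ Finset.range n, (2 * j + 2 * mcxCount ((j + 1) / 2) + 2 * mcxCount (j / 2))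

theorem cnotCount_stepVCircuit (n : ℕ) (φ lam : ℝ) :
    (stepVCircuit n φ lam).cnotCount = stepCount n := by
  simp only [stepVCircuit, Circuit.cnotCount_flatten, List.map_map, stepCount]
  rw [Finset.sum_range, ← List.sum_ofFn, List.ofFn_eq_map, List.map_reverse, List.sum_reverse]
  congr 1
  exact List.map_congr_left fun j _ => cnotCount_stepWCircuit j φ lam

theorem mcxCount_le (k : ℕ) (hk : 1 ≤ k) : (mcxCount k : ℤ) ≤ 8 * k - 6 := by
  match k, hk with
  | 1, _ => norm_num [mcxCount]
  | 2, _ => norm_num [mcxCount]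
  | k + 3, _ => simp only [mcxCount]; push_cast; omega

theorem le_mcxCount (k : ℕ) : (8 * k - 12 : ℤ) ≤ mcxCount k := by
  match k with
  | 0 => norm_num [mcxCount]
  | 1 => norm_num [mcxCount]
  | 2 => norm_num [mcxCount]
  | k + 3 => simp only [mcxCount]; push_cast; omega

/-- The two halves of `n` controls sum to `n`, so passing to `n + 1` costs at most `2n + 16n - 24`,
exactly the increment of the quadratic. The constant `34` makes the bound an equality at `n = 2`. -/
theorem stepCount_le (n : ℕ) (hn : 1 ≤ n) : (stepCount n : ℤ) ≤ 9 * n ^ 2 - 33 * n + 34 := by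
  induction n, hn using Nat.le_induction with
  | base => simp [stepCount, mcxCount]
  | succ n hn ih =>
    rw [stepCount, Finset.sum_range_succ, ← stepCount]
    -- A single control leaves an empty half, where `mcxCount_le` is not available, so this case is
    -- computed directly.
    obtain rfl | hn2 := hn.eq_or_lt
    · norm_num [stepCount, mcxCount, Finset.sum_range_succ]
    · have h1 := mcxCount_le ((n + 1) / 2) (by omega)
      have h2 := mcxCount_le (n / 2) (by omega)
      have h3 : (((n + 1) / 2 : ℕ) : ℤ) + ((n / 2 : ℕ) : ℤ) = n := by omega
      push_cast at *
      linarith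

/-- The same induction with increment at least `2n + 16n - 48`; only the coefficient of `n²` matters
for the leading term. -/
theorem le_stepCount (n : ℕ) : (9 * n ^ 2 - 57 * n : ℤ) ≤ stepCount n := by
  induction n with
  | zero => simp [stepCount]
  | succ n ih =>
    rw [stepCount, Finset.sum_range_succ, ← stepCount]
    have h1 := le_mcxCount ((n + 1) / 2)
    have h2 := le_mcxCount (n / 2)
    have h3 : (((n + 1) / 2 : ℕ) : ℤ) + ((n / 2 : ℕ) : ℤ) = n := by omega
    push_cast at *
    linarith

end StepCircuit

/-! ### Passing from one axis to `d` axes. -/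

section Axes

variable {d n : ℕ}

theorem tensorAxes_mul (A B : Fin d → Op (Fin n)) :
    tensorAxes A * tensorAxes B = tensorAxes fun α => A α * B α := by
  ext x y
  simp only [tensorAxes, Matrix.mul_apply, Matrix.of_apply, ← Finset.prod_mul_distrib]
  rw [Finset.prod_univ_sum, Fintype.piFinset_univ]
  exact Fintype.sum_equiv (Equiv.curry _ _ _) _ _ fun z => rfl

theorem onAxis_apply (α : Fin d) (A : Op (Fin n)) (x y : Fin d × Fin n → Fin 2) :
    onAxis α A x y = if ∀ β, β ≠ α → ∀ j, x (β, j) = y (β, j) then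
      A (fun j => x (α, j)) (fun j => y (α, j)) else 0 := by
  simp only [onAxis, tensorAxes, Matrix.of_apply]
  rw [← Finset.mul_prod_erase _ _ (Finset.mem_univ α), Function.update_self]
  split_ifs with h
  · rw [Finset.prod_eq_one, mul_one]
    intro β hβ
    have hβ := Finset.ne_of_mem_erase hβ
    rw [Function.update_of_ne hβ, Matrix.one_apply, if_pos]
    exact funext fun j => h β hβ j
  · push Not at h
    obtain ⟨β, hβ, j, hj⟩ := h
    rw [Finset.prod_eq_zero (i := β), mul_zero]
    · simp [hβ]
    · rw [Function.update_of_ne hβ, Matrix.one_apply_ne]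
      exact fun h => hj (congrFun h j)

theorem onAxis_mul (α : Fin d) (A B : Op (Fin n)) :
    onAxis α (A * B) = onAxis α A * onAxis α B := by
  rw [onAxis, onAxis, onAxis, tensorAxes_mul]
  congr 1
  funext β
  by_cases h : β = α
  · subst h; simp
  · simp [h]

theorem onAxis_one (α : Fin d) : onAxis α (1 : Op (Fin n)) = 1 := by
  ext x y
  rw [onAxis_apply, Matrix.one_apply, Matrix.one_apply]
  by_cases h : x = y
  · simp [h]
  · rw [if_neg h]
    split_ifs with h1 h2
    · refine absurd (funext fun q => ?_) h
      by_cases hq : q.1 = α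
      · rw [← Prod.mk.eta (p := q), hq]
        exact congrFun h2 q.2
      · exact h1 q.1 hq q.2
    · rfl
    · rfl

/-- `onAxis` as a homomorphism of star algebras. -/
def onAxisHom (α : Fin d) : Op (Fin n) →⋆ₐ[ℂ] Op (Fin d × Fin n) where
  toFun := onAxis α
  map_one' := onAxis_one α
  map_mul' := onAxis_mul α
  map_zero' := by ext x y; simp [onAxis_apply]
  map_add' A B := by
    ext x y
    simp only [onAxis_apply, Matrix.add_apply]
    split_ifs <;> simp
  commutes' c := by
    ext x y
    rw [Algebra.algebraMap_eq_smul_one, Algebra.algebraMap_eq_smul_one, Matrix.smul_apply,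
      ← onAxis_one α, onAxis_apply, onAxis_apply]
    split_ifs <;> simp
  map_star' A := by
    ext x y
    simp only [Matrix.star_apply, onAxis_apply]
    simp only [eq_comm (a := x _)]
    split_ifs <;> simp

theorem onAxisHom_apply (α : Fin d) (A : Op (Fin n)) : onAxisHom α A = onAxis α A := rfl

/-- A star homomorphism between C⋆-algebras is contractive, so no explicit norm of a tensor product
is needed. -/
theorem norm_onAxis_le (α : Fin d) (A : Op (Fin n)) : ‖onAxis α A‖ ≤ ‖A‖ :=
  NonUnitalStarAlgHom.norm_apply_le (onAxisHom α) A

theorem onAxis_commute {α β : Fin d} (h : α ≠ β) (A B : Op (Fin n)) :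
    Commute (onAxis α A) (onAxis β B) := by
  rw [Commute, SemiconjBy, onAxis, onAxis, tensorAxes_mul, tensorAxes_mul]
  congr 1
  funext γ
  by_cases h1 : γ = α
  · subst h1; simp [Function.update_of_ne h]
  · simp [Function.update_of_ne h1]

theorem prod_onAxis (l : List (Fin d)) (hl : l.Nodup) (A : Fin d → Op (Fin n)) :
    (l.map fun α => onAxis α (A α)).prod = tensorAxes fun α => if α ∈ l then A α else 1 := by
  induction l with
  | nil =>
    ext x y
    simp only [List.map_nil, List.prod_nil, List.not_mem_nil, if_false, tensorAxes,
      Matrix.of_apply, Matrix.one_apply, Finset.prod_ite_zero, funext_iff, Finset.mem_univ,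
      true_implies, Finset.prod_const_one, Prod.forall]
  | cons β l ih =>
    rw [List.nodup_cons] at hl
    rw [List.map_cons, List.prod_cons, ih hl.2, onAxis, tensorAxes_mul]
    congr 1
    funext α
    by_cases h : α = β
    · subst h; simp [hl.1]
    · simp [h]

theorem onAxis_ucOp (α : Fin d) (t : Fin n) (F : (Fin n → Fin 2) → Matrix (Fin 2) (Fin 2) ℂ) :
    onAxis α (ucOp t F) = ucOp (α, t) fun y => F fun j => y (α, j) := by
  ext x y
  have hu : ∀ z : Fin d × Fin n → Fin 2, (fun j => Function.update z (α, t) 0 (α, j)) =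
      Function.update (fun j => z (α, j)) t 0 := fun z => by
    funext j
    simp [Function.update_apply]
  have hiff : Function.update x (α, t) 0 = Function.update y (α, t) 0 ↔
      (∀ β, β ≠ α → ∀ j, x (β, j) = y (β, j)) ∧
        Function.update (fun j => x (α, j)) t 0 = Function.update (fun j => y (α, j)) t 0 := by
    rw [← hu, ← hu]
    constructor
    · intro h
      refine ⟨fun β hβ j => ?_, by rw [h]⟩
      simpa [Function.update_apply, hβ] using congrFun h (β, j)
    · rintro ⟨h1, h2⟩
      funext ⟨β, j⟩
      by_cases hβ : β = α
      · subst hβ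
        exact congrFun h2 j
      · simp [hβ, h1 β hβ j]
  rw [onAxis_apply]
  simp only [ucOp, Matrix.of_apply, hiff, hu]
  split_ifs <;> simp_all

/-- The gate on the qubits of group `α`. -/
def Gate.onAxis (α : Fin d) : Gate (Fin n) → Gate (Fin d × Fin n)
  | .single q U => .single (α, q) U
  | .cnot c t h => .cnot (α, c) (α, t) (by simpa using h)

/-- The circuit on the qubits of group `α`. -/
def Circuit.onAxis (α : Fin d) (C : Circuit (Fin n)) : Circuit (Fin d × Fin n) :=
  C.map (Gate.onAxis α)

theorem Gate.toOp_onAxis (α : Fin d) (g : Gate (Fin n)) :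
    (g.onAxis α).toOp = HamSim.onAxis α g.toOp := by
  cases g with
  | single q U => simp only [Gate.onAxis, Gate.toOp, onQubit_eq_ucOp, onAxis_ucOp]
  | cnot c t h =>
    have h' : ((α, c) : Fin d × Fin n) ≠ (α, t) := by simpa using h
    simp only [Gate.onAxis, Gate.toOp, cnotOp_eq_ucOp h, cnotOp_eq_ucOp h', onAxis_ucOp]

theorem Circuit.eval_onAxis (α : Fin d) (C : Circuit (Fin n)) :
    (C.onAxis α).eval = HamSim.onAxis α C.eval := by
  induction C with
  | nil => simp [Circuit.onAxis, onAxis_one]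
  | cons g C ih =>
    rw [Circuit.eval_cons, onAxis_mul, ← ih, ← Gate.toOp_onAxis]
    rfl

theorem Circuit.cnotCount_onAxis (α : Fin d) (C : Circuit (Fin n)) :
    (C.onAxis α).cnotCount = C.cnotCount := by
  have : Gate.cnots ∘ Gate.onAxis α = (Gate.cnots : Gate (Fin n) → ℕ) := by
    funext g; cases g <;> rfl
  simp [Circuit.cnotCount, Circuit.onAxis, this]

/-- The circuit for one time step on all axes. -/
def stepCircuit (d n : ℕ) (φ lam : Fin d → ℝ) : Circuit (Fin d × Fin n) :=
  ((List.finRange d).map fun α => (stepVCircuit n (φ α) (lam α)).onAxis α).flatten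

theorem eval_stepCircuit (d n : ℕ) (φ lam : Fin d → ℝ) :
    (stepCircuit d n φ lam).eval = tensorAxes fun α => stepV n (φ α) (lam α) := by
  rw [stepCircuit, Circuit.eval_flatten, ← List.map_reverse, List.map_map]
  simp only [Function.comp_def, Circuit.eval_onAxis, eval_stepVCircuit]
  rw [prod_onAxis _ (List.nodup_reverse.mpr (List.nodup_finRange d))]
  simp

theorem cnotCount_stepCircuit (d n : ℕ) (φ lam : Fin d → ℝ) :
    (stepCircuit d n φ lam).cnotCount = d * stepCount n := by
  rw [stepCircuit, Circuit.cnotCount_flatten, List.map_map]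
  simp [Function.comp_def, Circuit.cnotCount_onAxis, cnotCount_stepVCircuit]

end Axes

/-! ### Product formula and norm estimates in a C⋆-algebra. -/

section CStar

open NormedSpace

variable {A : Type*} [CStarAlgebra A]

theorem exp_smul_mem_unitary {X : A} (hX : X ∈ skewAdjoint A) (s : ℝ) :
    exp (s • X) ∈ unitary A := by
  let _ : NormedAlgebra ℚ A := NormedAlgebra.restrictScalars ℚ ℂ A
  refine exp_mem_unitary_of_mem_skewAdjoint ?_
  rw [skewAdjoint.mem_iff, star_smul, skewAdjoint.mem_iff.mp hX, star_trivial, smul_neg]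

theorem exp_smul_mul_exp_smul_neg (X : A) (s : ℝ) : exp (s • X) * exp (s • -X) = 1 := by
  let _ : NormedAlgebra ℚ A := NormedAlgebra.restrictScalars ℚ ℂ A
  rw [smul_neg, ← exp_add_of_commute (Commute.refl _).neg_right, add_neg_cancel, exp_zero]

theorem exp_smul_neg_mul_exp_smul (X : A) (s : ℝ) : exp (s • -X) * exp (s • X) = 1 := by
  have := exp_smul_mul_exp_smul_neg (-X) s
  rwa [neg_neg] at this

/-- The derivative of `e^{-uY} X e^{uY}` is `e^{-uY} [X, Y] e^{uY}`, whose norm is constant because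
the exponentials are unitary; integrate over `[0, s]`. -/
theorem norm_commutator_exp_le {X Y : A} (hY : Y ∈ skewAdjoint A) {s : ℝ} (hs : 0 ≤ s) :
    ‖X * exp (s • Y) - exp (s • Y) * X‖ ≤ ‖X * Y - Y * X‖ * s := by
  have hY' : -Y ∈ skewAdjoint A := neg_mem hY
  have hderiv : ∀ u : ℝ, HasDerivAt (fun u : ℝ => exp (u • -Y) * X * exp (u • Y))
      (exp (u • -Y) * (X * Y - Y * X) * exp (u • Y)) u := by
    intro u
    have h1 := hasDerivAt_exp_smul_const (𝕂 := ℝ) (-Y) u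
    have h2 := hasDerivAt_exp_smul_const' (𝕂 := ℝ) Y u
    refine ((h1.mul_const X).mul h2).congr_deriv ?_
    generalize exp (u • -Y) = E
    noncomm_ring
  have hbound := norm_image_sub_le_of_norm_deriv_le_segment' (a := 0) (b := s)
    (C := ‖X * Y - Y * X‖) (fun u _ => (hderiv u).hasDerivWithinAt) (fun u _ => by
      rw [CStarRing.norm_mul_mem_unitary _ (exp_smul_mem_unitary hY u),
        CStarRing.norm_mem_unitary_mul _ (exp_smul_mem_unitary hY' u)]) s ⟨hs, le_refl s⟩
  have : X * exp (s • Y) - exp (s • Y) * X =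
      exp (s • Y) * (exp (s • -Y) * X * exp (s • Y) - exp ((0 : ℝ) • -Y) * X *
        exp ((0 : ℝ) • Y)) := by
    rw [mul_sub, ← mul_assoc, ← mul_assoc, exp_smul_mul_exp_smul_neg]
    simp
  rw [this, CStarRing.norm_mem_unitary_mul _ (exp_smul_mem_unitary hY s)]
  simpa using hbound

/-- The error of the first-order product formula for two summands. -/
theorem norm_exp_add_sub_exp_mul_exp_le {X Y : A} (hX : X ∈ skewAdjoint A)
    (hY : Y ∈ skewAdjoint A) : ‖exp (X + Y) - exp X * exp Y‖ ≤ ‖X * Y - Y * X‖ / 2 := by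
  have hXY : X + Y ∈ skewAdjoint A := add_mem hX hY
  have hXY' : -(X + Y) ∈ skewAdjoint A := neg_mem hXY
  -- The error is measured in the interaction picture, where the derivative contains only the
  -- commutator of `X` with `exp (s • Y)`.
  have hderiv : ∀ s : ℝ,
      HasDerivAt (fun s : ℝ => exp (s • X) * exp (s • Y) * exp (s • -(X + Y)) - 1)
        (exp (s • X) * (X * exp (s • Y) - exp (s • Y) * X) * exp (s • -(X + Y))) s := by
    intro s
    have h1 := hasDerivAt_exp_smul_const (𝕂 := ℝ) X s
    have h2 := hasDerivAt_exp_smul_const (𝕂 := ℝ) Y s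
    have h3 := hasDerivAt_exp_smul_const' (𝕂 := ℝ) (-(X + Y)) s
    refine (((h1.mul h2).mul h3).sub_const 1).congr_deriv ?_
    rw [Pi.mul_apply]
    generalize exp (s • -(X + Y)) = E
    noncomm_ring
  -- The derivative has norm at most `‖[X, Y]‖ s`; integrating over `[0, 1]` produces the factor
  -- `1/2`.
  have hbound := image_norm_le_of_norm_deriv_right_le_deriv_boundary (a := 0) (b := 1)
    (B := fun s => ‖X * Y - Y * X‖ * (s ^ 2 / 2)) (B' := fun s => ‖X * Y - Y * X‖ * s)
    (fun s _ => (hderiv s).continuousAt.continuousWithinAt)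
    (fun s _ => (hderiv s).hasDerivWithinAt) (by simp)
    (fun s => by
      refine (((hasDerivAt_pow 2 s).div_const 2).const_mul ‖X * Y - Y * X‖).congr_deriv ?_
      simp) (fun s hs => by
      rw [CStarRing.norm_mul_mem_unitary _ (exp_smul_mem_unitary hXY' s),
        CStarRing.norm_mem_unitary_mul _ (exp_smul_mem_unitary hX s)]
      exact norm_commutator_exp_le hY hs.1) (x := 1) (by simp)
  have hu := exp_smul_mem_unitary hXY 1
  have : exp (X + Y) - exp X * exp Y =
      -((exp ((1 : ℝ) • X) * exp ((1 : ℝ) • Y) * exp ((1 : ℝ) • -(X + Y)) - 1) *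
        exp ((1 : ℝ) • (X + Y))) := by
    rw [sub_mul, mul_assoc _ _ (exp ((1 : ℝ) • (X + Y))), exp_smul_neg_mul_exp_smul]
    simp
  rw [this, norm_neg, CStarRing.norm_mul_mem_unitary _ hu]
  refine hbound.trans (le_of_eq ?_)
  ring

theorem exp_list_sum {ι : Type*} (l : List ι) (f : ι → A) (h : ∀ i j, Commute (f i) (f j)) :
    exp (l.map f).sum = (l.map fun i => exp (f i)).prod := by
  let _ : NormedAlgebra ℚ A := NormedAlgebra.restrictScalars ℚ ℂ A
  induction l with
  | nil => simp
  | cons i l ih =>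
    rw [List.map_cons, List.sum_cons, exp_add_of_commute, ih, List.map_cons, List.prod_cons]
    refine Commute.list_sum_right _ _ fun x hx => ?_
    obtain ⟨j, -, rfl⟩ := List.mem_map.mp hx
    exact h i j

/-- Telescoping: replacing one factor at a time changes the product by the error of that factor, as
the unitary factors around it preserve the norm. -/
theorem norm_list_prod_sub_le {ι : Type*} (l : List ι) (f g : ι → A)
    (hf : ∀ i, f i ∈ unitary A) (hg : ∀ i, g i ∈ unitary A) :
    ‖(l.map f).prod - (l.map g).prod‖ ≤ (l.map fun i => ‖f i - g i‖).sum := by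
  induction l with
  | nil => simp
  | cons i l ih =>
    have hgl : (l.map g).prod ∈ unitary A := by
      refine list_prod_mem fun x hx => ?_
      obtain ⟨j, -, rfl⟩ := List.mem_map.mp hx
      exact hg j
    simp only [List.map_cons, List.prod_cons, List.sum_cons]
    have : f i * (l.map f).prod - g i * (l.map g).prod =
        (f i - g i) * (l.map g).prod + f i * ((l.map f).prod - (l.map g).prod) := by
      noncomm_ring
    rw [this]
    refine (norm_add_le _ _).trans (add_le_add ?_ ?_)
    · rw [CStarRing.norm_mul_mem_unitary _ hgl]
    · rwa [CStarRing.norm_mem_unitary_mul _ (hf i)]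

theorem norm_pow_sub_pow_le {U V : A} (hU : U ∈ unitary A) (hV : V ∈ unitary A) (r : ℕ) :
    ‖U ^ r - V ^ r‖ ≤ r * ‖U - V‖ := by
  have := norm_list_prod_sub_le (List.range r) (fun _ => U) (fun _ => V) (fun _ => hU)
    (fun _ => hV)
  simpa using this

theorem norm_le_one_of_isStarProjection {p : A} (hs : star p = p) (hp : p * p = p) : ‖p‖ ≤ 1 := by
  have h := CStarRing.norm_star_mul_self (x := p)
  rw [hs, hp] at h
  by_contra! hlt
  nlinarith

/-- If `a` and `b` are self-adjoint, `a` is an involution, `b` is a partial isometry, and `a` maps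
the range of `b` to its kernel, then the commutator of `a` and `b` is a partial isometry. -/
theorem norm_commutator_le_one {a b : A} (ha : star a = a) (hb : star b = b) (haa : a * a = 1)
    (hbb : b * b * b = b) (hbab : b * a * b = 0) : ‖a * b - b * a‖ ≤ 1 := by
  have haa' : ∀ x, a * (a * x) = x := fun x => by rw [← mul_assoc, haa, one_mul]
  have hbb0 : b * (b * b) = b := by rw [← mul_assoc, hbb]
  have hbb' : ∀ x, b * (b * (b * x)) = b * x := fun x => by
    rw [← mul_assoc, ← mul_assoc, hbb]
  have hbab0 : b * (a * b) = 0 := by rw [← mul_assoc, hbab]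
  have hbab' : ∀ x, b * (a * (b * x)) = 0 := fun x => by
    rw [← mul_assoc, ← mul_assoc, hbab, zero_mul]
  -- The mixed terms contain `b a b` and vanish. What remains is a sum of the projections `b²` and
  -- `a b² a`, orthogonal because `b a b = 0`, hence a projection.
  have hC : star (a * b - b * a) * (a * b - b * a) = b * b + a * (b * (b * a)) := by
    simp only [star_sub, star_mul, ha, hb, mul_sub, sub_mul, mul_assoc, haa', hbab', hbab0]
    simp
  have hp : ‖b * b + a * (b * (b * a))‖ ≤ 1 := by
    refine norm_le_one_of_isStarProjection ?_ ?_
    · simp only [star_add, star_mul, ha, hb, mul_assoc]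
    · simp only [mul_add, add_mul, mul_assoc, haa', hbab', hbb', hbb0, mul_zero, add_zero,
        zero_add]
  have h := CStarRing.norm_star_mul_self (x := a * b - b * a)
  rw [hC] at h
  by_contra! hlt
  nlinarith

end CStar

/-! ### Spectral and product relations of the Hamiltonian terms. -/

section Ladder

variable {n : ℕ}

/-- `I^{⊗(n-j)} ⊗ B ⊗ A^{⊗(j-1)}`. -/
def ladder (j : Fin n) (A B : Matrix (Fin 2) (Fin 2) ℂ) : Op (Fin n) :=
  tensorQubits fun k => if k < j then A else if k = j then B else 1

theorem ladder_mul (j : Fin n) (A B A' B' : Matrix (Fin 2) (Fin 2) ℂ) :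
    ladder j A B * ladder j A' B' = ladder j (A * A') (B * B') := by
  rw [ladder, ladder, ladder, tensorQubits_mul]
  congr 1
  funext k
  split_ifs <;> simp

theorem ladder_conjTranspose (j : Fin n) (A B : Matrix (Fin 2) (Fin 2) ℂ) :
    (ladder j A B)ᴴ = ladder j Aᴴ Bᴴ := by
  rw [ladder, ladder, tensorQubits_conjTranspose]
  congr 1
  funext k
  split_ifs <;> simp

theorem ladder_apply (j : Fin n) (A B : Matrix (Fin 2) (Fin 2) ℂ) (x y : Fin n → Fin 2) :
    ladder j A B x y = B (x j) (y j) *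
      ∏ k ∈ Finset.univ.erase j,
        (if k < j then A else 1 : Matrix (Fin 2) (Fin 2) ℂ) (x k) (y k) := by
  rw [ladder, tensorQubits, Matrix.of_apply, ← Finset.mul_prod_erase _ _ (Finset.mem_univ j)]
  congr 1
  · simp
  · refine Finset.prod_congr rfl fun k hk => ?_
    simp [Finset.ne_of_mem_erase hk]

theorem ladder_linear (j : Fin n) (A B B' : Matrix (Fin 2) (Fin 2) ℂ) (a b : ℂ) :
    ladder j A (a • B + b • B') = a • ladder j A B + b • ladder j A B' := by
  ext x y
  simp only [Matrix.add_apply, Matrix.smul_apply, ladder_apply, smul_eq_mul]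
  ring

theorem onQubit_eq_ladder (j : Fin n) (A : Matrix (Fin 2) (Fin 2) ℂ) :
    onQubit j A = ladder j 1 A := by
  rw [onQubit, ladder]
  congr 1
  funext k
  by_cases h : k = j
  · subst h; simp
  · simp [h]

/-- The summand `e^{iλ} s_j⁻ + e^{-iλ} s_j⁺` of the Hamiltonian of one axis. -/
def hop (j : Fin n) (lam : ℝ) : Op (Fin n) :=
  Complex.exp (Complex.I * lam) • sMinus j + Complex.exp (-(Complex.I * lam)) • sPlus j

theorem sMinus_eq_ladder (j : Fin n) : sMinus j = ladder j sigma10 sigma01 := rfl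

theorem sPlus_eq_ladder (j : Fin n) : sPlus j = ladder j sigma01 sigma10 := rfl

theorem prod_cnotOp {j : Fin n} (l : List (Fin n)) (hn : (j :: l).Nodup) :
    (l.map fun m => cnotOp j m).prod =
      monoOp (fun _ => 1) fun y m => if m ∈ l then y m + y j else y m := by
  induction l with
  | nil => simpa [Function.id_def] using monoOp_one.symm
  | cons m l ih =>
    simp only [List.nodup_cons, List.mem_cons, not_or] at hn
    obtain ⟨⟨hjm, hjl⟩, hml, hl⟩ := hn
    have hm : cnotOp j m = monoOp (fun _ => 1) fun y => Function.update y m (y m + y j) := by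
      ext x y; simp [cnotOp, monoOp]
    rw [List.map_cons, List.prod_cons, ih (List.nodup_cons.mpr ⟨hjl, hl⟩), hm, monoOp_mul]
    congr 1
    · funext y; simp
    · funext y k
      by_cases hk : k = m
      · subst hk; simp [hml, hjl]
      · simp [hk]

theorem monoOp_conj_apply {τ : (Fin n → Fin 2) → Fin n → Fin 2} (hτ : Function.Involutive τ)
    (M : Op (Fin n)) (x y : Fin n → Fin 2) :
    (monoOp (fun _ => 1) τ * M * (monoOp (fun _ => 1) τ)ᴴ) x y = M (τ x) (τ y) := by
  rw [Matrix.mul_apply, Finset.sum_eq_single (τ y)]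
  · rw [Matrix.mul_apply, Finset.sum_eq_single (τ x)]
    · simp [monoOp, Matrix.conjTranspose_apply, hτ x, hτ y]
    · intro z _ hz
      have : x ≠ τ z := fun h => hz (by rw [h, hτ])
      simp [monoOp, this]
    · simp
  · intro z _ hz
    have : y ≠ τ z := fun h => hz (by rw [h, hτ])
    simp [monoOp, Matrix.conjTranspose_apply, this]
  · simp

/-- Conjugation by CNOT gates with control `j` and all targets below `j`. -/
theorem cnots_conj_ladder (j : Fin n) (B A : Matrix (Fin 2) (Fin 2) ℂ)
    (h : ∀ b c, B b c ≠ 0 → ∀ e f : Fin 2, sigma11 (e + b) (f + c) = A e f) :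
    ((below j).map fun m => cnotOp j m).prod * ladder j sigma11 B *
      (((below j).map fun m => cnotOp j m).prod)ᴴ = ladder j A B := by
  rw [prod_cnotOp _ (nodup_below j)]
  have hτ : Function.Involutive
      fun (y : Fin n → Fin 2) m => if m ∈ below j then y m + y j else y m := by
    intro y
    funext m
    have h2 : ∀ b c : Fin 2, b + c + c = b := by decide
    by_cases hm : m < j <;> simp [mem_below, hm, h2]
  ext x y
  rw [monoOp_conj_apply hτ, ladder_apply, ladder_apply]
  simp only [mem_below, lt_irrefl, if_false]
  -- Both sides carry the factor `B (x j) (y j)`; where it is nonzero, `h` identifies the shifted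
  -- entries of `sigma11` with those of `A`.
  by_cases h0 : B (x j) (y j) = 0
  · rw [h0, zero_mul, zero_mul]
  · congr 1
    refine Finset.prod_congr rfl fun k hk => ?_
    by_cases hkj : k < j
    · simp only [hkj, if_true, h _ _ h0]
    · simp only [hkj, if_false]

theorem hadamard_phase_conj (lam : ℝ) :
    phase (-lam) * (hadamard * Matrix.diagonal ![1, -1] * hadamard) * phase lam =
      Complex.exp (Complex.I * lam) • sigma01 + Complex.exp (-(Complex.I * lam)) • sigma10 := by
  have h : hadamard * Matrix.diagonal ![1, -1] * hadamard = pauliX := by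
    have hZ : (Matrix.diagonal ![1, -1] : Matrix (Fin 2) (Fin 2) ℂ) = !![1, 0; 0, -1] := by
      ext a b; fin_cases a <;> fin_cases b <;> simp
    rw [hadamard_conj, hZ]
    ext a b; fin_cases a <;> fin_cases b <;> norm_num [pauliX]
  rw [h]
  ext a b
  fin_cases a <;> fin_cases b <;>
    simp [phase, pauliX, sigma01, sigma10, Matrix.mul_apply]

/-- The gate `bellU` diagonalizes `hop`. -/
theorem hop_eq (j : Fin n) (lam : ℝ) :
    hop j lam =
      bellU j (-lam) * ladder j sigma11 (Matrix.diagonal ![1, -1]) * (bellU j (-lam))ᴴ := by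
  have hb : bellU j (-lam) = ((below j).map fun m => cnotOp j m).prod *
      (ladder j 1 (phase (-lam)) * ladder j 1 hadamard) := by
    rw [bellU, onQubit_eq_ladder, onQubit_eq_ladder, mul_assoc]
    rfl
  have hL : ladder j 1 (phase (-lam)) * ladder j 1 hadamard *
      ladder j sigma11 (Matrix.diagonal ![1, -1]) *
      (ladder j 1 (phase (-lam)) * ladder j 1 hadamard)ᴴ =
      Complex.exp (Complex.I * lam) • ladder j sigma11 sigma01 +
        Complex.exp (-(Complex.I * lam)) • ladder j sigma11 sigma10 := by
    rw [← ladder_linear, ← hadamard_phase_conj]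
    simp only [ladder_mul, ladder_conjTranspose, Matrix.conjTranspose_one, one_mul, mul_one,
      Matrix.conjTranspose_mul, hadamard_conjTranspose, phase_conjTranspose, neg_neg, mul_assoc]
  have hm := cnots_conj_ladder j sigma01 sigma10 (by
    intro b c hbc e f
    fin_cases b <;> fin_cases c <;> simp [sigma01] at hbc
    fin_cases e <;> fin_cases f <;> simp [sigma11, sigma10])
  have hp := cnots_conj_ladder j sigma10 sigma01 (by
    intro b c hbc e f
    fin_cases b <;> fin_cases c <;> simp [sigma10] at hbc
    fin_cases e <;> fin_cases f <;> simp [sigma11, sigma01])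
  rw [hop, sMinus_eq_ladder, sPlus_eq_ladder, ← hm, ← hp, hb]
  generalize ((below j).map fun m => cnotOp j m).prod = C at *
  calc _ = C * (Complex.exp (Complex.I * lam) • ladder j sigma11 sigma01 +
        Complex.exp (-(Complex.I * lam)) • ladder j sigma11 sigma10) * Cᴴ := by
        simp only [mul_add, add_mul, Matrix.mul_smul, Matrix.smul_mul]
    _ = _ := by
      rw [← hL]
      simp only [Matrix.conjTranspose_mul, mul_assoc]

theorem ladder_diagonal (j : Fin n) (r : Fin 2 → ℂ) :
    ladder j sigma11 (Matrix.diagonal r) =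
      Matrix.diagonal fun y : Fin n → Fin 2 => if ∀ k < j, y k = 1 then r (y j) else 0 :=
  tensorQubits_controls j r

theorem exp_conj_bellU (j : Fin n) (lam : ℝ) (D : Op (Fin n)) :
    NormedSpace.exp (bellU j lam * D * (bellU j lam)ᴴ) =
      bellU j lam * NormedSpace.exp D * (bellU j lam)ᴴ := by
  have h := bellU_mul_conjTranspose j lam
  have hu : IsUnit (bellU j lam) := IsUnit.of_mul_eq_one _ h
  rw [← Matrix.inv_eq_right_inv h, Matrix.exp_conj _ _ hu]

/-- In the basis that diagonalizes `hop` the exponential is computed entrywise. The angle is `2 * φ`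
because `rz θ` is `exp (-i θ Z / 2)`. -/
theorem stepW_eq_exp (j : Fin n) (φ lam : ℝ) :
    stepW j φ lam = NormedSpace.exp ((-(Complex.I * φ)) • hop j lam) := by
  rw [hop_eq, ← Matrix.smul_mul, ← Matrix.mul_smul, exp_conj_bellU, stepW, mcRZ_eq_diagonal,
    ladder_diagonal, ← Matrix.diagonal_smul, Matrix.exp_diagonal]
  congr 3
  funext y
  rw [Pi.coe_exp, ← Complex.exp_eq_exp_ℂ]
  by_cases h : ∀ k < j, y k = 1
  · simp only [if_pos h, Pi.smul_apply, smul_eq_mul]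
    obtain hy | hy : y j = 0 ∨ y j = 1 := by omega
    · simp only [hy, rz]
      simp
      congr 1
      ring
    · simp only [hy, rz]
      simp
      congr 1
      ring
  · simp [if_neg h]

theorem conjTranspose_hop (j : Fin n) (lam : ℝ) : (hop j lam)ᴴ = hop j lam := by
  have h : (ladder j sigma11 (Matrix.diagonal ![1, -1]))ᴴ =
      ladder j sigma11 (Matrix.diagonal ![1, -1]) := by
    rw [ladder_conjTranspose]
    congr 1
    · ext a b; fin_cases a <;> fin_cases b <;> simp [sigma11]
    · ext a b; fin_cases a <;> fin_cases b <;> simp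
  rw [hop_eq]
  simp only [Matrix.conjTranspose_mul, Matrix.conjTranspose_conjTranspose, h, mul_assoc]

/-- The eigenvalues are `0` and `±1`, so `hop` is a partial isometry. -/
theorem hop_cube (j : Fin n) (lam : ℝ) : hop j lam * hop j lam * hop j lam = hop j lam := by
  have h : ladder j sigma11 (Matrix.diagonal ![1, -1]) *
      (ladder j sigma11 (Matrix.diagonal ![1, -1]) *
        ladder j sigma11 (Matrix.diagonal ![1, -1])) =
      ladder j sigma11 (Matrix.diagonal ![1, -1]) := by
    simp only [ladder_mul]
    congr 1
    · ext a b; fin_cases a <;> fin_cases b <;> simp [sigma11]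
    · ext a b; fin_cases a <;> fin_cases b <;> simp
  have hU : ∀ X, (bellU j (-lam))ᴴ * (bellU j (-lam) * X) = X := fun X => by
    rw [← mul_assoc, mul_eq_one_comm.mp (bellU_mul_conjTranspose j (-lam)), one_mul]
  have hD : ∀ X, ladder j sigma11 (Matrix.diagonal ![1, -1]) *
      (ladder j sigma11 (Matrix.diagonal ![1, -1]) *
        (ladder j sigma11 (Matrix.diagonal ![1, -1]) * X)) =
      ladder j sigma11 (Matrix.diagonal ![1, -1]) * X := fun X => by
    rw [← mul_assoc, ← mul_assoc, mul_assoc (ladder _ _ _) (ladder _ _ _), h]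
  rw [hop_eq]
  simp only [mul_assoc, hU, hD]

theorem sigma01_mul_self : sigma01 * sigma01 = 0 := by
  ext a b; fin_cases a <;> fin_cases b <;> simp [sigma01]

theorem sigma10_mul_self : sigma10 * sigma10 = 0 := by
  ext a b; fin_cases a <;> fin_cases b <;> simp [sigma10]

theorem ladder_mul_ladder_eq_zero {j k : Fin n} (q : Fin n)
    {A B A' B' : Matrix (Fin 2) (Fin 2) ℂ}
    (h : (if q < j then A else if q = j then B else 1) *
      (if q < k then A' else if q = k then B' else 1) = 0) :
    ladder j A B * ladder k A' B' = 0 := by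
  rw [ladder, ladder, tensorQubits_mul]
  exact tensorQubits_eq_zero q h

/-- In each of the four products of ladder operators some qubit carries the square of a nilpotent:
qubit `i` for equal signs, qubit `j` for opposite signs. A qubit below both `j` and `k` is
essential, which excludes the first term of the Hamiltonian. -/
theorem hop_mul_hop_of_lt {j k i : Fin n} (hij : i < j) (hjk : j < k) (lam : ℝ) :
    hop j lam * hop k lam = 0 := by
  have hik := hij.trans hjk
  simp only [hop, sMinus_eq_ladder, sPlus_eq_ladder, add_mul, mul_add, Matrix.smul_mul,
    Matrix.mul_smul]
  rw [ladder_mul_ladder_eq_zero i (by simp [hij, hik, sigma10_mul_self]),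
    ladder_mul_ladder_eq_zero j (by simp [hjk, sigma10_mul_self]),
    ladder_mul_ladder_eq_zero j (by simp [hjk, sigma01_mul_self]),
    ladder_mul_ladder_eq_zero i (by simp [hij, hik, sigma01_mul_self])]
  simp

theorem hop_mul_hop {j k i : Fin n} (hij : i < j) (hik : i < k) (hjk : j ≠ k) (lam : ℝ) :
    hop j lam * hop k lam = 0 := by
  rcases lt_or_gt_of_ne hjk with h | h
  · exact hop_mul_hop_of_lt hij h lam
  · rw [← conjTranspose_hop j, ← conjTranspose_hop k, ← Matrix.conjTranspose_mul,
      hop_mul_hop_of_lt hik h, Matrix.conjTranspose_zero]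

theorem ladder_first {i : Fin n} (hi : ∀ k, ¬ k < i) (A A' B : Matrix (Fin 2) (Fin 2) ℂ) :
    ladder i A B = ladder i A' B := by
  simp only [ladder, hi, if_false]

theorem hop_first_mul_self {i : Fin n} (hi : ∀ k, ¬ k < i) (lam : ℝ) :
    hop i lam * hop i lam = 1 := by
  have h : ladder i sigma11 (Matrix.diagonal ![1, -1]) *
      ladder i sigma11 (Matrix.diagonal ![1, -1]) = 1 := by
    rw [ladder_mul, ladder_first hi _ 1, ← onQubit_eq_ladder, onQubit_eq_ucOp, ← ucOp_one i]
    refine ucOp_congr fun _ => ?_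
    ext a b; fin_cases a <;> fin_cases b <;> simp
  have hU : ∀ X, (bellU i (-lam))ᴴ * (bellU i (-lam) * X) = X := fun X => by
    rw [← mul_assoc, mul_eq_one_comm.mp (bellU_mul_conjTranspose i (-lam)), one_mul]
  have hD : ∀ X, ladder i sigma11 (Matrix.diagonal ![1, -1]) *
      (ladder i sigma11 (Matrix.diagonal ![1, -1]) * X) = X := fun X => by
    rw [← mul_assoc, h, one_mul]
  rw [hop_eq]
  simp only [mul_assoc, hU, hD, bellU_mul_conjTranspose]

theorem ladder_mul_mul_eq_zero {j i k : Fin n} (q : Fin n)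
    {A B A' B' A'' B'' : Matrix (Fin 2) (Fin 2) ℂ}
    (h : (if q < j then A else if q = j then B else 1) *
      (if q < i then A' else if q = i then B' else 1) *
      (if q < k then A'' else if q = k then B'' else 1) = 0) :
    ladder j A B * ladder i A' B' * ladder k A'' B'' = 0 := by
  rw [ladder, ladder, ladder, tensorQubits_mul, tensorQubits_mul]
  exact tensorQubits_eq_zero q h

/-- The terms with equal outer signs vanish at qubit `k` by nilpotency. Those with opposite signs
vanish at qubit `i`, where either summand of the middle factor meets an equal neighbour. -/
theorem hop_mul_hop_first_mul_hop {i k : Fin n} (hi : ∀ k, ¬ k < i) (hik : i < k) (lam : ℝ) :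
    hop k lam * hop i lam * hop k lam = 0 := by
  have h1 : hop i lam = ladder i 1 (Complex.exp (Complex.I * lam) • sigma01 +
      Complex.exp (-(Complex.I * lam)) • sigma10) := by
    rw [ladder_linear, hop, sMinus_eq_ladder, sPlus_eq_ladder, ladder_first hi sigma10 1,
      ladder_first hi sigma01 1]
  have h2 : ∀ a b : ℂ, sigma10 * (a • sigma01 + b • sigma10) * sigma01 = 0 := fun a b => by
    rw [mul_add, Matrix.mul_smul, Matrix.mul_smul, sigma10_mul_self, smul_zero, add_zero,
      Matrix.smul_mul, mul_assoc, sigma01_mul_self, mul_zero, smul_zero]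
  have h3 : ∀ a b : ℂ, sigma01 * (a • sigma01 + b • sigma10) * sigma10 = 0 := fun a b => by
    rw [mul_add, Matrix.mul_smul, Matrix.mul_smul, sigma01_mul_self, smul_zero, zero_add,
      Matrix.smul_mul, mul_assoc, sigma10_mul_self, mul_zero, smul_zero]
  rw [h1]
  simp only [hop, sMinus_eq_ladder, sPlus_eq_ladder, add_mul, mul_add, Matrix.smul_mul,
    Matrix.mul_smul]
  rw [ladder_mul_mul_eq_zero k (by simp [hi, hik.ne', sigma01_mul_self]),
    ladder_mul_mul_eq_zero i (by simp [hik, h3]),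
    ladder_mul_mul_eq_zero i (by simp [hik, h2]),
    ladder_mul_mul_eq_zero k (by simp [hi, hik.ne', sigma10_mul_self])]
  simp

end Ladder

/-! ### Trotter error of a step and of the whole simulation. -/

section Trotter

theorem smul_mem_skewAdjoint_of_star_eq {A : Type*} [CStarAlgebra A] {X : A} (hX : star X = X)
    (t : ℝ) : (-(Complex.I * t)) • X ∈ skewAdjoint A := by
  rw [skewAdjoint.mem_iff, star_smul, hX, ← neg_smul]
  congr 1
  simp

theorem star_hop {n : ℕ} (j : Fin n) (lam : ℝ) : star (hop j lam) = hop j lam :=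
  conjTranspose_hop j lam

theorem star_list_sum_hop {n : ℕ} (l : List (Fin n)) (lam : ℝ) :
    star (l.map fun j => hop j lam).sum = (l.map fun j => hop j lam).sum := by
  induction l with
  | nil => simp
  | cons j l ih => simp only [List.map_cons, List.sum_cons, star_add, star_hop, ih]

theorem norm_commutator_list_sum_le {A ι : Type*} [CStarAlgebra A] (a : A) (b : ι → A)
    (l : List ι) (h : ∀ i ∈ l, ‖a * b i - b i * a‖ ≤ 1) :
    ‖a * (l.map b).sum - (l.map b).sum * a‖ ≤ l.length := by
  induction l with
  | nil => simp
  | cons i l ih =>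
    rw [List.forall_mem_cons] at h
    have : a * ((i :: l).map b).sum - ((i :: l).map b).sum * a =
        (a * b i - b i * a) + (a * (l.map b).sum - (l.map b).sum * a) := by
      simp only [List.map_cons, List.sum_cons]
      noncomm_ring
    rw [this, List.length_cons, Nat.cast_succ, add_comm]
    exact (norm_add_le _ _).trans (by linarith [ih h.2, h.1])

/-- The Trotter error of one time step on one axis. -/
theorem norm_exp_sub_stepV_le (n : ℕ) (hn : 1 ≤ n) (φ lam : ℝ) :
    ‖NormedSpace.exp ((-(Complex.I * φ)) • ∑ j : Fin n, hop j lam) - stepV n φ lam‖ ≤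
      φ ^ 2 * ((n : ℝ) - 1) / 2 := by
  obtain ⟨m, rfl⟩ : ∃ m, n = m + 1 := ⟨n - 1, by omega⟩
  set L : List (Fin (m + 1)) := (List.finRange m).map Fin.succ with hL
  have hLlen : L.length = m := by simp [hL]
  have hLpos : ∀ k ∈ L, 0 < k := fun k hk => by
    obtain ⟨i, -, rfl⟩ := List.mem_map.mp hk
    exact Fin.succ_pos i
  set B : Op (Fin (m + 1)) := (L.map fun k => hop k lam).sum with hB
  have hfin : List.finRange (m + 1) = 0 :: L := List.finRange_succ
  have hsum : ∑ j : Fin (m + 1), hop j lam = hop 0 lam + B := by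
    rw [← List.sum_ofFn, List.ofFn_eq_map, hfin, List.map_cons, List.sum_cons]
  -- Qubit `0` lies below all other indices, so the remaining terms annihilate each other and the
  -- exponential of their sum factors without error.
  have hexpB : NormedSpace.exp ((-(Complex.I * φ)) • B) =
      (L.map fun k => stepW k φ lam).prod := by
    have h1 : (-(Complex.I * φ)) • B = (((List.finRange m).map fun i =>
        (-(Complex.I * φ)) • hop i.succ lam)).sum := by
      rw [hB, hL, List.map_map, List.smul_sum, List.map_map]
      rfl
    rw [h1, exp_list_sum, hL, List.map_map]
    · congr 1
      exact List.map_congr_left fun i _ => (stepW_eq_exp _ _ _).symm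
    · intro i k
      by_cases hik : i = k
      · subst hik; exact Commute.refl _
      · have h : ∀ i k : Fin m, i ≠ k → hop i.succ lam * hop k.succ lam = 0 := fun i k hik =>
          hop_mul_hop (Fin.succ_pos i) (Fin.succ_pos k) (by simpa using hik) lam
        rw [Commute, SemiconjBy, Matrix.smul_mul, Matrix.mul_smul, Matrix.smul_mul,
          Matrix.mul_smul, h i k hik, h k i (Ne.symm hik)]
  have hV : stepV (m + 1) φ lam = NormedSpace.exp ((-(Complex.I * φ)) • hop 0 lam) *
      NormedSpace.exp ((-(Complex.I * φ)) • B) := by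
    rw [stepV, hfin, List.map_cons, List.prod_cons, hexpB, stepW_eq_exp]
  -- Each of the `n - 1` commutators with the first term contributes at most one.
  have hcomm : ‖hop 0 lam * B - B * hop 0 lam‖ ≤ m := by
    refine (norm_commutator_list_sum_le _ _ _ fun k hk => ?_).trans_eq
      (congrArg Nat.cast hLlen)
    exact norm_commutator_le_one (star_hop _ _) (star_hop _ _)
      (hop_first_mul_self (fun k => not_lt.mpr (Fin.zero_le k)) lam) (hop_cube k lam)
      (hop_mul_hop_first_mul_hop (fun k => not_lt.mpr (Fin.zero_le k)) (hLpos k hk) lam)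
  rw [hV, hsum, smul_add]
  refine (norm_exp_add_sub_exp_mul_exp_le
    (smul_mem_skewAdjoint_of_star_eq (star_hop 0 lam) φ)
    (smul_mem_skewAdjoint_of_star_eq (star_list_sum_hop L lam) φ)).trans ?_
  have : ((-(Complex.I * φ)) • hop 0 lam) * ((-(Complex.I * φ)) • B) -
      ((-(Complex.I * φ)) • B) * ((-(Complex.I * φ)) • hop 0 lam) =
      ((-(Complex.I * φ)) * (-(Complex.I * φ))) • (hop 0 lam * B - B * hop 0 lam) := by
    simp only [Matrix.smul_mul, Matrix.mul_smul, smul_smul, smul_sub]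
  rw [this, norm_smul]
  have hc : ‖(-(Complex.I * φ)) * (-(Complex.I * φ))‖ = φ ^ 2 := by
    simp [← sq]
  rw [hc]
  push_cast
  have := mul_le_mul_of_nonneg_left hcomm (sq_nonneg φ)
  linarith

theorem stepV_mem_unitary (n : ℕ) (φ lam : ℝ) : stepV n φ lam ∈ unitary (Op (Fin n)) := by
  rw [← eval_stepVCircuit]
  exact Unitary.mem_iff.mpr ⟨Circuit.eval_conjTranspose_mul _, Circuit.eval_mul_conjTranspose _⟩

theorem onAxis_mem_unitary {d n : ℕ} (α : Fin d) {U : Op (Fin n)} (hU : U ∈ unitary (Op (Fin n))) :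
    onAxis α U ∈ unitary (Op (Fin d × Fin n)) :=
  Unitary.map_mem (onAxisHom α) hU

theorem exp_onAxis {d n : ℕ} (α : Fin d) (M : Op (Fin n)) :
    NormedSpace.exp (onAxis α M) = onAxis α (NormedSpace.exp M) := by
  have hc : Continuous (onAxisHom (n := n) α) :=
    AddMonoidHomClass.continuous_of_bound (onAxisHom α) 1 fun M => by
      rw [one_mul]; exact norm_onAxis_le α M
  let _ : NormedAlgebra ℚ (Op (Fin n)) := NormedAlgebra.restrictScalars ℚ ℂ _
  exact (NormedSpace.map_exp (onAxisHom α) hc M).symm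

theorem hamiltonian_eq {d : ℕ} (n : ℕ) (γ : ℝ) (η lam : Fin d → ℝ) :
    hamiltonian n γ η lam =
      ((List.finRange d).map fun α =>
        onAxis α (((γ * η α : ℝ) : ℂ) • ∑ j : Fin n, hop j (lam α))).sum := by
  rw [← List.ofFn_eq_map, List.sum_ofFn, hamiltonian, Finset.smul_sum]
  refine Finset.sum_congr rfl fun α _ => ?_
  simp only [← onAxisHom_apply, map_smul, map_sum, hop, map_add, Finset.smul_sum, smul_smul,
    Complex.ofReal_mul]

theorem evolution_eq_prod {d : ℕ} (n : ℕ) (γ : ℝ) (η lam : Fin d → ℝ) (T : ℝ) :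
    evolution n γ η lam T =
      ((List.finRange d).map fun α => onAxis α (NormedSpace.exp
        ((-(Complex.I * ((γ * η α * T : ℝ) : ℂ))) • ∑ j : Fin n, hop j (lam α)))).prod := by
  have h : (-(Complex.I * T)) • hamiltonian n γ η lam = ((List.finRange d).map fun α =>
      onAxis α ((-(Complex.I * ((γ * η α * T : ℝ) : ℂ))) • ∑ j : Fin n, hop j (lam α))).sum := by
    rw [hamiltonian_eq, List.smul_sum, List.map_map]
    congr 1
    refine List.map_congr_left fun α _ => ?_
    simp only [Function.comp_apply, ← onAxisHom_apply, map_smul, smul_smul]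
    congr 1
    push_cast
    ring
  rw [evolution, h, exp_list_sum]
  · simp only [exp_onAxis]
  · intro α β
    by_cases hαβ : α = β
    · subst hαβ
      rw [Commute, SemiconjBy]
    · exact onAxis_commute hαβ _ _

theorem evolution_eq_pow {d : ℕ} (n : ℕ) (γ : ℝ) (η lam : Fin d → ℝ) (T : ℝ) {r : ℕ}
    (hr : r ≠ 0) : evolution n γ η lam T = evolution n γ η lam (T / r) ^ r := by
  rw [evolution, evolution, ← Matrix.exp_nsmul, ← Nat.cast_smul_eq_nsmul ℂ, smul_smul]
  congr 2
  have : (r : ℂ) ≠ 0 := by exact_mod_cast hr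
  push_cast
  field_simp

theorem sum_hop_exp_mem_unitary (n : ℕ) (lam t : ℝ) :
    NormedSpace.exp ((-(Complex.I * t)) • ∑ j : Fin n, hop j lam) ∈ unitary (Op (Fin n)) := by
  have hs : star (∑ j : Fin n, hop j lam) = ∑ j : Fin n, hop j lam := by
    rw [star_sum]
    exact Finset.sum_congr rfl fun j _ => star_hop j lam
  have := exp_smul_mem_unitary (smul_mem_skewAdjoint_of_star_eq hs t) 1
  rwa [one_smul] at this

theorem tensorAxes_eq_prod {d n : ℕ} (A : Fin d → Op (Fin n)) :
    tensorAxes A = ((List.finRange d).map fun α => onAxis α (A α)).prod := by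
  rw [prod_onAxis _ (List.nodup_finRange d)]
  simp

theorem evolution_mem_unitary {d : ℕ} (n : ℕ) (γ : ℝ) (η lam : Fin d → ℝ) (T : ℝ) :
    evolution n γ η lam T ∈ unitary (Op (Fin d × Fin n)) := by
  rw [evolution_eq_prod]
  refine list_prod_mem fun x hx => ?_
  obtain ⟨α, -, rfl⟩ := List.mem_map.mp hx
  exact onAxis_mem_unitary α (sum_hop_exp_mem_unitary n _ _)

theorem tensorAxes_stepV_mem_unitary {d : ℕ} (n : ℕ) (φ lam : Fin d → ℝ) :
    tensorAxes (fun α => stepV n (φ α) (lam α)) ∈ unitary (Op (Fin d × Fin n)) := by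
  rw [tensorAxes_eq_prod]
  refine list_prod_mem fun x hx => ?_
  obtain ⟨α, -, rfl⟩ := List.mem_map.mp hx
  exact onAxis_mem_unitary α (stepV_mem_unitary n _ _)

/-- The error of one time step. -/
theorem norm_evolution_sub_step_le {d : ℕ} (n : ℕ) (hn : 1 ≤ n) (γ : ℝ) (η lam : Fin d → ℝ)
    (t : ℝ) :
    ‖evolution n γ η lam t - tensorAxes fun α => stepV n (γ * η α * t) (lam α)‖ ≤
      γ ^ 2 * t ^ 2 * ((n : ℝ) - 1) * (∑ α, η α ^ 2) / 2 := by
  rw [evolution_eq_prod, tensorAxes_eq_prod]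
  refine (norm_list_prod_sub_le _ _ _
    (fun α => onAxis_mem_unitary α (sum_hop_exp_mem_unitary n _ _))
    (fun α => onAxis_mem_unitary α (stepV_mem_unitary n _ _))).trans ?_
  rw [← List.ofFn_eq_map, List.sum_ofFn, Finset.mul_sum, Finset.sum_div]
  refine Finset.sum_le_sum fun α _ => ?_
  rw [← onAxisHom_apply, ← onAxisHom_apply, ← map_sub, onAxisHom_apply]
  refine (norm_onAxis_le α _).trans ((norm_exp_sub_stepV_le n hn _ _).trans (le_of_eq ?_))
  ring

/-- The error of the simulation circuit. -/
theorem norm_evolution_sub_simCircuit_le {d : ℕ} (n : ℕ) (hn : 1 ≤ n) (γ : ℝ)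
    (η lam : Fin d → ℝ) (T ε : ℝ) (hε : 0 < ε) :
    ‖evolution n γ η lam T - (simCircuit (stepCircuit d n) γ η lam T ε).eval‖ ≤ ε := by
  have hr1 : 1 ≤ numSteps n γ η T ε := le_max_left _ _
  have hr : γ ^ 2 * T ^ 2 * ((n : ℝ) - 1) * (∑ α, η α ^ 2) / (2 * ε) ≤ numSteps n γ η T ε := by
    refine (Nat.le_ceil _).trans ?_
    exact Nat.cast_le.mpr (le_max_right _ _)
  rw [simCircuit, Circuit.eval_rep, eval_stepCircuit]
  generalize numSteps n γ η T ε = r at *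
  have hr0 : (0 : ℝ) < r := by exact_mod_cast hr1
  rw [evolution_eq_pow n γ η lam T (r := r) (by omega)]
  refine (norm_pow_sub_pow_le (evolution_mem_unitary n γ η lam _)
    (tensorAxes_stepV_mem_unitary n _ _) r).trans ?_
  refine (mul_le_mul_of_nonneg_left (norm_evolution_sub_step_le n hn γ η lam (T / r))
    hr0.le).trans ?_
  rw [div_le_iff₀ (by positivity)] at hr
  -- A step of length `T / r` has error of order `1 / r²`, so `r` steps leave a total of order `1 /
  -- r`; `hr` says that it is at most `ε`.
  have : (r : ℝ) * (γ ^ 2 * (T / r) ^ 2 * ((n : ℝ) - 1) * (∑ α, η α ^ 2) / 2) =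
      γ ^ 2 * T ^ 2 * ((n : ℝ) - 1) * (∑ α, η α ^ 2) / (2 * r) := by
    field_simp
  rw [this, div_le_iff₀ (by positivity)]
  linarith

theorem cnotCount_simCircuit {d : ℕ} (n : ℕ) (γ : ℝ) (η lam : Fin d → ℝ) (T ε : ℝ) :
    ((simCircuit (stepCircuit d n) γ η lam T ε).cnotCount : ℝ) =
      numSteps n γ η T ε * (d * stepCount n) := by
  rw [simCircuit, Circuit.cnotCount_rep, cnotCount_stepCircuit]
  push_cast
  ring

end Trotter

/-! ### Asymptotics of the gate count. -/

section Counting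

theorem cast_stepCount_le (n : ℕ) (hn : 1 ≤ n) :
    (stepCount n : ℝ) ≤ 9 * (n : ℝ) ^ 2 - 33 * n + 34 := by
  exact_mod_cast stepCount_le n hn

theorem le_cast_stepCount (n : ℕ) : 9 * (n : ℝ) ^ 2 - 57 * n ≤ (stepCount n : ℝ) := by
  exact_mod_cast le_stepCount n

theorem numSteps_le {d : ℕ} (n : ℕ) (hn : 1 ≤ n) (γ : ℝ) (η : Fin d → ℝ) (T ε : ℝ) (hε : 0 < ε) :
    (numSteps n γ η T ε : ℝ) ≤
      (n - 1) * (γ ^ 2 * T ^ 2 * (∑ α, η α ^ 2) / ε) / 2 + 1 := by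
  have hn' : (1 : ℝ) ≤ n := by exact_mod_cast hn
  have hS : 0 ≤ ∑ α, η α ^ 2 := Finset.sum_nonneg fun α _ => sq_nonneg _
  have hx : 0 ≤ γ ^ 2 * T ^ 2 * ((n : ℝ) - 1) * (∑ α, η α ^ 2) / (2 * ε) := by
    have : 0 ≤ (n : ℝ) - 1 := by linarith
    positivity
  have heq : γ ^ 2 * T ^ 2 * ((n : ℝ) - 1) * (∑ α, η α ^ 2) / (2 * ε) =
      (n - 1) * (γ ^ 2 * T ^ 2 * (∑ α, η α ^ 2) / ε) / 2 := by
    field_simp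
  rw [numSteps, Nat.cast_max, ← heq]
  refine max_le (by simpa using hx) (Nat.ceil_lt_add_one hx).le

theorem le_numSteps {d : ℕ} (n : ℕ) (γ : ℝ) (η : Fin d → ℝ) (T ε : ℝ) (hε : 0 < ε) :
    (n - 1) * (γ ^ 2 * T ^ 2 * (∑ α, η α ^ 2) / ε) / 2 ≤ (numSteps n γ η T ε : ℝ) := by
  have heq : γ ^ 2 * T ^ 2 * ((n : ℝ) - 1) * (∑ α, η α ^ 2) / (2 * ε) =
      (n - 1) * (γ ^ 2 * T ^ 2 * (∑ α, η α ^ 2) / ε) / 2 := by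
    field_simp
  rw [numSteps, ← heq]
  refine (Nat.le_ceil _).trans ?_
  exact Nat.cast_le.mpr (le_max_right _ _)

/-- When `n x ≥ 1`, the rounding term `1` is at most `n x`, so `r ≤ 3/2 n x`; and `c ≤ 10 n²`
because `(n - 1)(n + 34) ≥ 0`. Hence `15`. -/
theorem steps_mul_count_le {n x r c : ℝ} (hn : 1 ≤ n) (hx : 0 ≤ x) (hnx : 1 ≤ n * x)
    (hr : r ≤ (n - 1) * x / 2 + 1) (hc0 : 0 ≤ c) (hc : c ≤ 9 * n ^ 2 - 33 * n + 34) :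
    r * c ≤ 15 * (n ^ 3 * x) := by
  have h1 : r ≤ 3 / 2 * (n * x) := by nlinarith
  have h2 : c ≤ 10 * n ^ 2 := by nlinarith
  calc r * c ≤ (3 / 2 * (n * x)) * c := mul_le_mul_of_nonneg_right h1 hc0
    _ ≤ (3 / 2 * (n * x)) * (10 * n ^ 2) := mul_le_mul_of_nonneg_left h2 (by linarith)
    _ = 15 * (n ^ 3 * x) := by ring

/-- From below the loss is at most `33 n² x`, within tolerance once `n δ ≥ 22/3`, so `8` suffices.
From above the excess is at most `9 n²`, coming from rounding `r` up, and `n x δ ≥ 2` absorbs it.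
The condition `2 ≤ n` gives `c ≤ 9 n²`. -/
theorem abs_steps_mul_count_sub_le {n x r c δ : ℝ} (hδ : 0 < δ) (hn2 : 2 ≤ n) (hn : 8 / δ ≤ n)
    (hnx : 2 / δ ≤ n * x) (hx : 0 ≤ x) (hr : r ≤ (n - 1) * x / 2 + 1)
    (hr' : (n - 1) * x / 2 ≤ r) (hc0 : 0 ≤ c) (hc : c ≤ 9 * n ^ 2 - 33 * n + 34)
    (hc' : 9 * n ^ 2 - 57 * n ≤ c) :
    |r * c - 9 * n ^ 3 * x / 2| ≤ δ * (9 * n ^ 3 * x / 2) := by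
  have h8 : 8 ≤ n * δ := (div_le_iff₀ hδ).mp hn
  have h2 : 2 ≤ n * x * δ := (div_le_iff₀ hδ).mp hnx
  have hn1 : 0 ≤ n - 1 := by linarith
  have hr0 : 0 ≤ (n - 1) * x / 2 := by positivity
  rw [abs_le]
  constructor
  · have e1 : (n - 1) * x / 2 * (9 * n ^ 2 - 57 * n) ≤ r * c :=
      (mul_le_mul_of_nonneg_left hc' hr0).trans (mul_le_mul_of_nonneg_right hr' hc0)
    have e2 : 0 ≤ (n * δ - 8) * (9 * n ^ 2 * x / 2) :=
      mul_nonneg (by linarith) (by positivity)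
    have e3 : 0 ≤ n ^ 2 * x := by positivity
    have e4 : 0 ≤ n * x := by positivity
    nlinarith
  · have e0 : c ≤ 9 * n ^ 2 := by linarith
    have e1 : r ≤ n * x / 2 + 1 := by linarith
    have e2 : r * c ≤ (n * x / 2 + 1) * (9 * n ^ 2) :=
      (mul_le_mul_of_nonneg_right e1 hc0).trans (mul_le_mul_of_nonneg_left e0 (by positivity))
    have e3 : 0 ≤ (n * x * δ - 2) * (9 * n ^ 2 / 2) :=
      mul_nonneg (by linarith) (by positivity)
    nlinarith

end Counting

end HamSim

end

theorem theorem1 :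
    ∃ step : (d n : ℕ) → (Fin d → ℝ) → (Fin d → ℝ) → HamSim.Circuit (Fin d × Fin n),
      -- `step d n φ λ` implements the one time step unitary `⨂_α V(φ_α, λ_α)` exactly
      (∀ (d n : ℕ), 1 ≤ d → 1 ≤ n → ∀ φ lam : Fin d → ℝ,
        (step d n φ lam).eval = HamSim.tensorAxes (fun α => HamSim.stepV n (φ α) (lam α)) ∧
        ((step d n φ lam).cnotCount : ℝ) ≤ d * (9 * (n : ℝ) ^ 2 - 33 * n + 34)) ∧
      -- its `r`-fold repetition implements `exp(-i H T)` within the additive error `ε`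
      (∀ (d n : ℕ), 1 ≤ d → 1 ≤ n → ∀ (γ : ℝ) (η lam : Fin d → ℝ) (T ε : ℝ), 0 < ε →
        ‖HamSim.evolution n γ η lam T -
            (HamSim.simCircuit (step d n) γ η lam T ε).eval‖ ≤ ε ∧
        ((HamSim.simCircuit (step d n) γ η lam T ε).cnotCount : ℝ) ≤
          HamSim.numSteps n γ η T ε * (d * (9 * (n : ℝ) ^ 2 - 33 * n + 34))) ∧
      -- the number of CNOT gates is `O(d n³ γ² T² ∑ η_α² / ε)` with an absolute constant
      (∃ C : ℝ, 0 < C ∧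
        ∀ (d n : ℕ), 1 ≤ d → 1 ≤ n → ∀ (γ : ℝ) (η lam : Fin d → ℝ) (T ε : ℝ), 0 < ε →
          ε ≤ n * (γ ^ 2 * T ^ 2 * ∑ α, η α ^ 2) →
          ((HamSim.simCircuit (step d n) γ η lam T ε).cnotCount : ℝ) ≤
            C * (d * (n : ℝ) ^ 3 * γ ^ 2 * T ^ 2 * (∑ α, η α ^ 2) / ε)) ∧
      -- its leading term is `9 d n³ γ² T² ∑ η_α² / (2 ε)`
      (∀ δ : ℝ, 0 < δ → ∃ K : ℝ, 0 < K ∧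
        ∀ (d n : ℕ), 1 ≤ d → 1 ≤ n → ∀ (γ : ℝ) (η lam : Fin d → ℝ) (T ε : ℝ), 0 < ε →
          K ≤ n → K * ε ≤ n * (γ ^ 2 * T ^ 2 * ∑ α, η α ^ 2) →
          |((HamSim.simCircuit (step d n) γ η lam T ε).cnotCount : ℝ) -
              9 * d * (n : ℝ) ^ 3 * γ ^ 2 * T ^ 2 * (∑ α, η α ^ 2) / (2 * ε)| ≤
            δ * (9 * d * (n : ℝ) ^ 3 * γ ^ 2 * T ^ 2 * (∑ α, η α ^ 2) / (2 * ε))) := by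
  refine ⟨HamSim.stepCircuit, fun d n _ hn φ lam => ⟨HamSim.eval_stepCircuit d n φ lam, ?_⟩,
    fun d n _ hn γ η lam T ε hε =>
      ⟨HamSim.norm_evolution_sub_simCircuit_le n hn γ η lam T ε hε, ?_⟩,
    ⟨15, by norm_num, fun d n _ hn γ η lam T ε hε h => ?_⟩,
    -- One threshold `K` serves both limits: `8 / δ` is what `n` needs, and it exceeds the `2 / δ`
    -- that `n x` needs.
    fun δ hδ => ⟨max 2 (8 / δ), by positivity, fun d n _ hn γ η lam T ε hε hK h => ?_⟩⟩
  · rw [HamSim.cnotCount_stepCircuit]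
    push_cast
    exact mul_le_mul_of_nonneg_left (HamSim.cast_stepCount_le n hn) (Nat.cast_nonneg d)
  · rw [HamSim.cnotCount_simCircuit]
    exact mul_le_mul_of_nonneg_left (mul_le_mul_of_nonneg_left (HamSim.cast_stepCount_le n hn)
      (Nat.cast_nonneg d)) (Nat.cast_nonneg _)
  · have hS : 0 ≤ ∑ α, η α ^ 2 := Finset.sum_nonneg fun α _ => sq_nonneg _
    have key := HamSim.steps_mul_count_le (n := n)
      (x := γ ^ 2 * T ^ 2 * (∑ α, η α ^ 2) / ε) (by exact_mod_cast hn) (by positivity)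
      (by rw [← mul_div_assoc, le_div_iff₀ hε]; linarith)
      (HamSim.numSteps_le n hn γ η T ε hε) (Nat.cast_nonneg (HamSim.stepCount n))
      (HamSim.cast_stepCount_le n hn)
    rw [HamSim.cnotCount_simCircuit]
    calc _ = (d : ℝ) * (HamSim.numSteps n γ η T ε * HamSim.stepCount n) := by ring
      _ ≤ d * (15 * ((n : ℝ) ^ 3 * (γ ^ 2 * T ^ 2 * (∑ α, η α ^ 2) / ε))) :=
        mul_le_mul_of_nonneg_left key (Nat.cast_nonneg d)
      _ = _ := by ring
  · have hS : 0 ≤ ∑ α, η α ^ 2 := Finset.sum_nonneg fun α _ => sq_nonneg _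
    have hK2 : 2 / δ ≤ max 2 (8 / δ) :=
      (div_le_div_of_nonneg_right (by norm_num) hδ.le).trans (le_max_right _ _)
    have key := HamSim.abs_steps_mul_count_sub_le (n := n)
      (x := γ ^ 2 * T ^ 2 * (∑ α, η α ^ 2) / ε) hδ ((le_max_left _ _).trans hK)
      ((le_max_right _ _).trans hK)
      (by
        rw [← mul_div_assoc, le_div_iff₀ hε]
        exact (mul_le_mul_of_nonneg_right hK2 hε.le).trans h) (by positivity)
      (HamSim.numSteps_le n hn γ η T ε hε) (HamSim.le_numSteps n γ η T ε hε)
      (Nat.cast_nonneg (HamSim.stepCount n)) (HamSim.cast_stepCount_le n hn)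
      (HamSim.le_cast_stepCount n)
    have hcount : (HamSim.numSteps n γ η T ε : ℝ) * (d * HamSim.stepCount n) -
        9 * d * (n : ℝ) ^ 3 * γ ^ 2 * T ^ 2 * (∑ α, η α ^ 2) / (2 * ε) =
        d * (HamSim.numSteps n γ η T ε * HamSim.stepCount n -
          9 * (n : ℝ) ^ 3 * (γ ^ 2 * T ^ 2 * (∑ α, η α ^ 2) / ε) / 2) := by
      field_simp
    rw [HamSim.cnotCount_simCircuit, hcount, abs_mul, Nat.abs_cast]
    calc _ ≤ (d : ℝ) * (δ * (9 * (n : ℝ) ^ 3 * (γ ^ 2 * T ^ 2 * (∑ α, η α ^ 2) / ε) / 2)) :=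
        mul_le_mul_of_nonneg_left key (Nat.cast_nonneg d)
      _ = _ := by field_simp
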